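/- Conventions. A spectral triple $(A,H,D)$ associated to a unital C*-algebra $\mathcal{A}$ consists of a Hilbert space $H$ carrying a faithful unital representation $\pi$ of $\mathcal{A}$, a dense self-adjoint subalgebra $A\subseteq\mathcal{A}$, and a (generally unbounded) self-adjoint operator $D$ on $H$, such that for every $a\in A$ the commutator $[D,\pi(a)]$, with its natural domain $\{x\in\mathrm{dom}\,D : \pi(a)x\in \mathrm{dom}\,D\}$, is densely defined and bounded, and such that $(I+D^2)^{-1}$ is compact. For $s>0$ the triple is called $s$-summable if $(I+D^2)^{-s/2}$ is of trace class. Let $\mathcal{A}\subseteq B(H)$ be a concrete unital C*-algebra containing $I_H$, with a spectral triple $(A,H,D)$ for the identity representation, and let $P\in B(H)$ be an orthogonal projection. Write $C(PH)$ for the compact operators on $PH$, $\kappa: B(PH)\to \mathcal{Q}(PH)=B(PH)/C(PH)$ for the quotient map onto the Calkin algebra, and $T(a):=Pa|_{PH}$. The quadruple $((A,H,D),P)$ is of Toeplitz type if - $P$ commutes with $D$ (that is, $PD\subseteq DP$), $[P,a]$ is compact for all $a\in\mathcal{A}$, and the homomorphism $\varphi:\mathcal{A}\to\mathcal{Q}(PH)$,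 $\varphi(a):=\kappa(T(a))$, is faithful; - for each $a\in A$ the commutators $[PD,a]$ and $[(I-P)D,a]$ are densely defined and bounded, and $\mathrm{dom}([D,a])\cap PH$ and $\mathrm{dom}([D,a])\cap (I-P)H$ are dense in $PH$ and $(I-P)H$ respectively; - $D_p:=D|_{PH}$ has trivial kernel. For such a quadruple put $D_q:=D|_{(I-P)H}$ and let: - $\mathcal{T}$ be the C*-algebra on $PH$ generated by $\{T(a): a\in\mathcal{A}\}\cup C(PH)$; - $A_c$ be the set of $k\in C(PH)$ such that $D_pk$ and $kD_p$ are densely defined and bounded, and $A_t:=\{T(a)+k : a\in A,\ k\in A_c\}\subseteq\mathcal{T}$; - $K:=PH\oplus H=PH\oplus PH\oplus (I-P)H$; - for $\alpha,\beta>0$, $$D_{\alpha,\beta}:=\begin{pmatrix}0&\beta D_p&0\\ \beta D_p&\frac1\alpha D_p&0\\0&0&\frac1\alpha D_q\end{pmatrix}\quad\text{on } K,$$ with domain $\mathrm{dom}\,D_p\oplus\mathrm{dom}\,D_p\oplus\mathrm{dom}\,D_q$. Proposition. Let $((A,H,D),P)$ be a quadruple of Toeplitz type, and suppose that $T(a)$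 maps $\mathrm{dom}\,D_p$ into itself for every $a\in A$ (this is automatic if every $a\in A$ maps $\mathrm{dom}\,D$ into itself). Then there is a unital $*$-homomorphism $\rho:\mathcal{T}\to\mathcal{A}$ with $\varphi(\rho(t))=\kappa(t)$ for all $t\in\mathcal{T}$, and for all $\alpha,\beta>0$ with $\alpha\beta\le 1$ the triple $(A_t,K,D_{\alpha,\beta})$ is a spectral triple associated to $\mathcal{T}$, where $\mathcal{T}$ is represented on $K=PH\oplus H$ by $\pi(t):=t\oplus\rho(t)$. For every real $s>0$, $(A_t,K,D_{\alpha,\beta})$ is $s$-summable if and only if $(A,H,D)$ is $s$-summable. -/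

import Mathlib

namespace ToeplitzTriple

open scoped InnerProductSpace

noncomputable section

/-! ### Unbounded operators -/

section Unbounded

variable {E F G : Type*}
  [NormedAddCommGroup E] [InnerProductSpace ℂ E]
  [NormedAddCommGroup F] [InnerProductSpace ℂ F]
  [NormedAddCommGroup G] [InnerProductSpace ℂ G]

/-- The product `S b` of an unbounded operator `S` and a bounded operator `b`, on its natural
domain `{x | b x ∈ dom S}`. -/
def mulBounded (S : F →ₗ.[ℂ] G) (b : E →L[ℂ] F) : E →ₗ.[ℂ] G where
  domain := S.domain.comap (b : E →ₗ[ℂ] F)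
  toFun := S.toFun ∘ₗ (b : E →ₗ[ℂ] F).restrict (fun _ hx => hx)

/-- The product `b S` of a bounded operator `b` and an unbounded operator `S`, with domain
`dom S`. -/
def boundedMul (b : F →L[ℂ] G) (S : E →ₗ.[ℂ] F) : E →ₗ.[ℂ] G :=
  (b : F →ₗ[ℂ] G).compPMap S

/-- The commutator `[S, b] = S b - b S`, with its natural domain `{x ∈ dom S | b x ∈ dom S}`. -/
def opCommutator (S : E →ₗ.[ℂ] E) (b : E →L[ℂ] E) : E →ₗ.[ℂ] E :=
  mulBounded S b - boundedMul b S

/-- An operator that is densely defined and bounded (on its domain). -/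
def IsDenselyDefinedBounded (S : E →ₗ.[ℂ] F) : Prop :=
  Dense (S.domain : Set E) ∧ ∃ C : ℝ, ∀ x : S.domain, ‖S x‖ ≤ C * ‖(x : E)‖

/-- `R` is the bounded operator `(I + D²)⁻¹`: a two-sided inverse of `I + D²`, where
`D²` has the domain `{x ∈ dom D | D x ∈ dom D}`. -/
structure IsInvOneAddSq (D : E →ₗ.[ℂ] E) (R : E →L[ℂ] E) : Prop where
  right_inv : ∀ y : E, ∃ (h₁ : R y ∈ D.domain) (h₂ : D ⟨R y, h₁⟩ ∈ D.domain),
    R y + D ⟨D ⟨R y, h₁⟩, h₂⟩ = y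
  left_inv : ∀ (x : D.domain) (h : D x ∈ D.domain), R ((x : E) + D ⟨D x, h⟩) = x

variable [CompleteSpace E]

/-- The trace class: `Tr |T| < ∞`, the trace being computed in an orthonormal basis. -/
def IsTraceClass (T : E →L[ℂ] E) : Prop :=
  ∃ (ι : Set E) (b : HilbertBasis ι ℂ E),
    Summable fun i => (⟪b i, CFC.abs T (b i)⟫_ℂ).re

/-- `s`-summability of a triple with Dirac operator `D`: `(I + D²)^(-s/2)` is of trace class. -/
def IsSummable (s : ℝ) (D : E →ₗ.[ℂ] E) : Prop :=
  ∃ R : E →L[ℂ] E, IsInvOneAddSq D R ∧ IsTraceClass (R ^ (s / 2))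

/-- `(A, E, D)` is a spectral triple associated to the unital C*-algebra `𝓑`, which is represented
on the Hilbert space `E` by `π`. -/
structure IsSpectralTriple {𝓑 : Type*} [CStarAlgebra 𝓑] (π : 𝓑 →⋆ₐ[ℂ] (E →L[ℂ] E))
    (A : Set 𝓑) (D : E →ₗ.[ℂ] E) : Prop where
  faithful : Function.Injective π
  isSelfAdjoint : IsSelfAdjoint D
  /-- `A` is a self-adjoint subalgebra (possibly without unit). -/
  isSubalgebra : ∃ S : NonUnitalStarSubalgebra ℂ 𝓑, (S : Set 𝓑) = A
  dense : Dense A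
  commutator_bounded : ∀ a ∈ A, IsDenselyDefinedBounded (opCommutator D (π a))
  compact : ∃ R : E →L[ℂ] E, IsInvOneAddSq D R ∧ IsCompactOperator R

end Unbounded

/-! ### The Calkin algebra -/

section Calkin

variable (E : Type*) [NormedAddCommGroup E] [InnerProductSpace ℂ E]

/-- The ideal of compact operators in `B(E)`. -/
def compactIdeal : Ideal (E →L[ℂ] E) where
  carrier := {k | IsCompactOperator k}
  add_mem' := fun ha hb => ha.add hb
  zero_mem' := isCompactOperator_zero
  smul_mem' := fun c _ hk => hk.clm_comp c

instance compactIdeal_isTwoSided : (compactIdeal E).IsTwoSided :=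
  ⟨fun b hk => IsCompactOperator.comp_clm hk b⟩

/-- The Calkin algebra `B(E) / C(E)`. -/
abbrev Calkin : Type _ := (E →L[ℂ] E) ⧸ compactIdeal E

/-- The quotient homomorphism onto the Calkin algebra. -/
def calkinMk : (E →L[ℂ] E) →+* Calkin E := Ideal.Quotient.mk (compactIdeal E)

end Calkin

/-! ### Quadruples of Toeplitz type

The projection `P` is given by its range, a closed subspace `M` of `H`. -/

section Toeplitz

variable {H : Type*} [NormedAddCommGroup H] [InnerProductSpace ℂ H] [CompleteSpace H]

/-- The compression `T(a) = P a | PH`. -/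
def compress (M : Submodule ℂ H) [CompleteSpace M] (a : H →L[ℂ] H) : M →L[ℂ] M :=
  M.orthogonalProjectionOnto ∘L a ∘L M.subtypeL

/-- The restriction `D | M` for a closed subspace `M` whose projection commutes with `D` (so that
`D` maps `M ∩ dom D` to `M`), as an operator on `M` with domain `M ∩ dom D`. -/
def restrict (D : H →ₗ.[ℂ] H) (M : Submodule ℂ H) [CompleteSpace M] : M →ₗ.[ℂ] M :=
  boundedMul M.orthogonalProjectionOnto (mulBounded D M.subtypeL)

/-- The orthogonal projection onto `M` commutes with the unbounded operator `D`: `P D ⊆ D P`. -/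
def ProjCommutes (D : H →ₗ.[ℂ] H) (M : Submodule ℂ H) [CompleteSpace M] : Prop :=
  ∀ x : D.domain, ∃ h : M.starProjection (x : H) ∈ D.domain,
    D ⟨M.starProjection (x : H), h⟩ = M.starProjection (D x)

/-- The map `φ : 𝓐 → Q(PH)`, `φ(a) = Pa|PH + C(PH)`. -/
def phi (𝓐 : StarSubalgebra ℂ (H →L[ℂ] H)) (M : Submodule ℂ H) [CompleteSpace M] (a : 𝓐) :
    Calkin M :=
  calkinMk M (compress M (a : H →L[ℂ] H))

/-- The projection `P` onto `M` is of Toeplitz type for a triple with C*-algebra `𝓐` and Dirac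
operator `D`. -/
structure IsToeplitzProjection (𝓐 : StarSubalgebra ℂ (H →L[ℂ] H)) (D : H →ₗ.[ℂ] H)
    (M : Submodule ℂ H) [CompleteSpace M] : Prop where
  commutes : ProjCommutes D M
  commutes_mod_compact : ∀ a ∈ 𝓐,
    IsCompactOperator (M.starProjection * a - a * M.starProjection : H →L[ℂ] H)
  faithful : Function.Injective (phi 𝓐 M)

/-- `((A, H, D), P)` is a quadruple of Toeplitz type, where `(A, H, D)` is a spectral triple
associated to the concrete unital C*-algebra `𝓐` on `H` and `P` is the projection onto `M`.

`[PD, a]` and `[(I - P)D, a]` have the same domain as `[D, a]`. -/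
structure IsToeplitzQuadruple (𝓐 : StarSubalgebra ℂ (H →L[ℂ] H))
    [IsClosed (𝓐 : Set (H →L[ℂ] H))] (A : Set 𝓐) (D : H →ₗ.[ℂ] H)
    (M : Submodule ℂ H) [CompleteSpace M] : Prop where
  isSpectralTriple : IsSpectralTriple 𝓐.subtype A D
  isToeplitzProjection : IsToeplitzProjection 𝓐 D M
  commutator_p : ∀ a ∈ A,
    IsDenselyDefinedBounded (opCommutator (boundedMul M.starProjection D) (a : H →L[ℂ] H))
  commutator_q : ∀ a ∈ A,
    IsDenselyDefinedBounded (opCommutator (boundedMul (1 - M.starProjection) D) (a : H →L[ℂ] H))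
  dense_p : ∀ a ∈ A, Dense {x : M | (x : H) ∈ (opCommutator D (a : H →L[ℂ] H)).domain}
  dense_q : ∀ a ∈ A, Dense {x : Mᗮ | (x : H) ∈ (opCommutator D (a : H →L[ℂ] H)).domain}
  ker_trivial : ∀ x : (restrict D M).domain, restrict D M x = 0 → x = 0

/-- The (unital) C*-algebra of operators on a Hilbert space generated by a set of operators. -/
def generatedCStarAlgebra (E : Type*) [NormedAddCommGroup E] [InnerProductSpace ℂ E]
    [CompleteSpace E] (s : Set (E →L[ℂ] E)) : StarSubalgebra ℂ (E →L[ℂ] E) :=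
  (StarAlgebra.adjoin ℂ s).topologicalClosure

theorem isClosed_generatedCStarAlgebra (E : Type*) [NormedAddCommGroup E] [InnerProductSpace ℂ E]
    [CompleteSpace E] (s : Set (E →L[ℂ] E)) :
    IsClosed (generatedCStarAlgebra E s : Set (E →L[ℂ] E)) :=
  StarSubalgebra.isClosed_topologicalClosure _

/-- The Toeplitz extension `𝓣`: the C*-algebra on `PH` generated by all `Pa|PH`, `a ∈ 𝓐`, and the
compact operators on `PH`. -/
def toeplitzExtension (𝓐 : StarSubalgebra ℂ (H →L[ℂ] H)) (M : Submodule ℂ H) [CompleteSpace M] :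
    StarSubalgebra ℂ (M →L[ℂ] M) :=
  generatedCStarAlgebra M (compress M '' (𝓐 : Set (H →L[ℂ] H)) ∪ {k | IsCompactOperator k})

instance toeplitzExtension_isClosed (𝓐 : StarSubalgebra ℂ (H →L[ℂ] H)) (M : Submodule ℂ H)
    [CompleteSpace M] : IsClosed (toeplitzExtension 𝓐 M : Set (M →L[ℂ] M)) :=
  isClosed_generatedCStarAlgebra M _

/-- `A_c`: the compact operators `k` on `PH` such that `D_p k` and `k D_p` are densely defined and
bounded. -/
def smoothCompacts (D : H →ₗ.[ℂ] H) (M : Submodule ℂ H) [CompleteSpace M] : Set (M →L[ℂ] M) :=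
  {k | IsCompactOperator k ∧ IsDenselyDefinedBounded (mulBounded (restrict D M) k) ∧
    IsDenselyDefinedBounded (boundedMul k (restrict D M))}

/-- `A_t = {T(a) + k | a ∈ A, k ∈ A_c}`, as a subset of `𝓣`. -/
def smoothToeplitz (𝓐 : StarSubalgebra ℂ (H →L[ℂ] H)) (A : Set 𝓐) (D : H →ₗ.[ℂ] H)
    (M : Submodule ℂ H) [CompleteSpace M] : Set (toeplitzExtension 𝓐 M) :=
  {t | ∃ a ∈ A, ∃ k ∈ smoothCompacts D M,
    (t : M →L[ℂ] M) = compress M (a : H →L[ℂ] H) + k}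

/-- The Hilbert space `K = PH ⊕ H`. -/
abbrev ExtSpace (M : Submodule ℂ H) : Type _ := WithLp 2 (M × H)

section Decomposition

variable (M : Submodule ℂ H) [CompleteSpace M]

/-- The embeddings `in₁`, `in₂`, `in₃` and the coordinate projections `pr₁`, `pr₂`, `pr₃` of the
decomposition `K = PH ⊕ PH ⊕ (I - P)H`. -/
def in₁ : M →L[ℂ] ExtSpace M :=
  ((WithLp.prodContinuousLinearEquiv 2 ℂ M H).symm : (M × H) →L[ℂ] ExtSpace M) ∘L
    ContinuousLinearMap.inl ℂ M H

def in₂ : M →L[ℂ] ExtSpace M :=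
  ((WithLp.prodContinuousLinearEquiv 2 ℂ M H).symm : (M × H) →L[ℂ] ExtSpace M) ∘L
    ContinuousLinearMap.inr ℂ M H ∘L M.subtypeL

def in₃ : Mᗮ →L[ℂ] ExtSpace M :=
  ((WithLp.prodContinuousLinearEquiv 2 ℂ M H).symm : (M × H) →L[ℂ] ExtSpace M) ∘L
    ContinuousLinearMap.inr ℂ M H ∘L Mᗮ.subtypeL

def pr₁ : ExtSpace M →L[ℂ] M := WithLp.fstL 2 ℂ M H

def pr₂ : ExtSpace M →L[ℂ] M := M.orthogonalProjectionOnto ∘L WithLp.sndL 2 ℂ M H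

def pr₃ : ExtSpace M →L[ℂ] Mᗮ := Mᗮ.orthogonalProjectionOnto ∘L WithLp.sndL 2 ℂ M H

/-- The Dirac operator `D_{α,β}` on `K = PH ⊕ PH ⊕ (I - P)H`, given by the matrix
`(0, β D_p, 0; β D_p, α⁻¹ D_p, 0; 0, 0, α⁻¹ D_q)`. The domain of a sum is the intersection of the
domains, so that the domain of `D_{α,β}` is `dom D_p ⊕ dom D_p ⊕ dom D_q`. -/
def extDirac (D : H →ₗ.[ℂ] H) (α β : ℝ) : ExtSpace M →ₗ.[ℂ] ExtSpace M :=
  boundedMul (in₁ M) ((β : ℂ) • mulBounded (restrict D M) (pr₂ M)) +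
  boundedMul (in₂ M) ((β : ℂ) • mulBounded (restrict D M) (pr₁ M) +
    (α : ℂ)⁻¹ • mulBounded (restrict D M) (pr₂ M)) +
  boundedMul (in₃ M) ((α : ℂ)⁻¹ • mulBounded (restrict D Mᗮ) (pr₃ M))

end Decomposition

end Toeplitz

end

end ToeplitzTriple

/-!
The triple `(A_t, K, D_{α,β})` is obtained from `(A, H, D)` by three constructions.

**The homomorphism `ρ`.** The pairs `(a, t)` in `𝓐 × B(PH)` such that `t - T(a)` is compact form a
closed star subalgebra, since `T` is multiplicative and star-preserving modulo compact operators
and the compact operators are closed. As `φ` is faithful, `t` determines `a`; so the projection to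
the second coordinate is an injective, hence isometric, star homomorphism. Its range is closed and
contains the generators of `𝓣`, and `ρ` is its inverse followed by the projection to the first
coordinate (`exists_symbol_hom`).

**The Dirac operator.** Unbounded operators are handled through their graphs. In `K = PH ⊕ H`, the
operator `D_{α,β}` is the product `B (D_p ⊕ D)`, where `B (x, w) = (β P w, β x + α⁻¹ w)` is
bounded, self-adjoint, invertible and commutes with `D_p ⊕ D` (`ProjCommutes.extDirac_eq`). Hence
`D_{α,β}` is self-adjoint (`isSelfAdjoint_boundedMul`), and its resolvent `(I + D_{α,β}²)⁻¹` is `(I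
+ (D_p ⊕ D)²)⁻¹` times a bounded operator (`IsInvOneAddSq.boundedMul_eq`), therefore compact. For
the summability, the two resolvents commute and each is at most a multiple of the other, and for
commuting positive operators such an inequality passes to all powers with nonnegative exponents
(`rpow_le_smul_rpow_of_commute`); finally, the powers of the resolvent of `D_p` are the
restrictions of the powers of the resolvent of `D`, so that adding the summand `D_p` to `D` changes
nothing (`isSummable_blockDiagPMap_iff`). The traces are computed in an arbitrary orthonormal basis
(`summable_inner_of_isTraceClass`).

**The algebra `A_t`.** On the vectors of `(I - P)H` in the domain of `[D, a]`, which are dense in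
`(I - P)H`, the operator `D_p P a` agrees with the bounded operator `[PD, a]`; so `D_p P a (I - P)`
is everywhere defined and bounded (`IsToeplitzQuadruple.mapsBounded_corner`), and `T(a) T(b) -
T(ab)` lies in `A_c`. The commutator `[D_p, T(a)]` is bounded, because `-[D_p, T(a)]` is contained
in the adjoint of the densely defined bounded operator `[D_p, T(a*)]`
(`IsToeplitzQuadruple.exists_bound_commutator_compress`). Hence `A_c` absorbs products with `T(a)`,
and `A_t` is a star subalgebra. It is dense because finite rank operators between
finite-dimensional subspaces of `dom D_p` are dense in the compact operators. The same bounds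
estimate the entries of the commutators `[D_{α,β}, π(t)]`
(`IsToeplitzQuadruple.commutator_extDirac`).
-/

namespace ToeplitzTriple

open scoped InnerProductSpace

noncomputable section

/-! ### Unbounded operators and their graphs -/

section Graph

variable {E F G : Type*}
  [NormedAddCommGroup E] [InnerProductSpace ℂ E]
  [NormedAddCommGroup F] [InnerProductSpace ℂ F]
  [NormedAddCommGroup G] [InnerProductSpace ℂ G]

theorem mem_domain_iff_exists_graph {S : E →ₗ.[ℂ] F} {x : E} :
    x ∈ S.domain ↔ ∃ y, (x, y) ∈ S.graph := LinearPMap.mem_domain_iff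

theorem mem_graph_iff_exists {S : E →ₗ.[ℂ] F} {x : E} {y : F} :
    (x, y) ∈ S.graph ↔ ∃ h : x ∈ S.domain, S ⟨x, h⟩ = y := by
  rw [LinearPMap.mem_graph_iff]
  constructor
  · rintro ⟨⟨z, hz⟩, rfl, h⟩
    exact ⟨hz, h⟩
  · rintro ⟨h, e⟩
    exact ⟨⟨x, h⟩, rfl, e⟩

theorem mem_graph_mulBounded {S : F →ₗ.[ℂ] G} {b : E →L[ℂ] F} {x : E} {y : G} :
    (x, y) ∈ (mulBounded S b).graph ↔ (b x, y) ∈ S.graph := by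
  rw [mem_graph_iff_exists, mem_graph_iff_exists]
  rfl

theorem mem_graph_boundedMul {S : E →ₗ.[ℂ] F} {b : F →L[ℂ] G} {x : E} {y : G} :
    (x, y) ∈ (boundedMul b S).graph ↔ ∃ z, (x, z) ∈ S.graph ∧ y = b z := by
  simp only [mem_graph_iff_exists]
  constructor
  · rintro ⟨h, rfl⟩
    exact ⟨S ⟨x, h⟩, ⟨h, rfl⟩, rfl⟩
  · rintro ⟨z, ⟨h, rfl⟩, rfl⟩
    exact ⟨h, rfl⟩

theorem mem_graph_add {S T : E →ₗ.[ℂ] F} {x : E} {y : F} :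
    (x, y) ∈ (S + T).graph ↔ ∃ u v, (x, u) ∈ S.graph ∧ (x, v) ∈ T.graph ∧ y = u + v := by
  simp only [mem_graph_iff_exists]
  constructor
  · rintro ⟨h, rfl⟩
    exact ⟨_, _, ⟨h.1, rfl⟩, ⟨h.2, rfl⟩, rfl⟩
  · rintro ⟨u, v, ⟨h, rfl⟩, ⟨h', rfl⟩, rfl⟩
    exact ⟨⟨h, h'⟩, rfl⟩

theorem mem_graph_sub {S T : E →ₗ.[ℂ] F} {x : E} {y : F} :
    (x, y) ∈ (S - T).graph ↔ ∃ u v, (x, u) ∈ S.graph ∧ (x, v) ∈ T.graph ∧ y = u - v := by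
  simp only [mem_graph_iff_exists]
  constructor
  · rintro ⟨h, rfl⟩
    exact ⟨_, _, ⟨h.1, rfl⟩, ⟨h.2, rfl⟩, rfl⟩
  · rintro ⟨u, v, ⟨h, rfl⟩, ⟨h', rfl⟩, rfl⟩
    exact ⟨⟨h, h'⟩, rfl⟩

theorem mem_graph_smul {S : E →ₗ.[ℂ] F} {c : ℂ} {x : E} {y : F} :
    (x, y) ∈ (c • S).graph ↔ ∃ z, (x, z) ∈ S.graph ∧ y = c • z := by
  simp only [mem_graph_iff_exists]
  constructor
  · rintro ⟨h, rfl⟩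
    exact ⟨S ⟨x, h⟩, ⟨h, rfl⟩, rfl⟩
  · rintro ⟨z, ⟨h, rfl⟩, rfl⟩
    exact ⟨h, rfl⟩

theorem mem_graph_opCommutator {S : E →ₗ.[ℂ] E} {b : E →L[ℂ] E} {x y : E} :
    (x, y) ∈ (opCommutator S b).graph ↔
      ∃ u v, (b x, u) ∈ S.graph ∧ (x, v) ∈ S.graph ∧ y = u - b v := by
  simp only [opCommutator, mem_graph_sub, mem_graph_mulBounded, mem_graph_boundedMul]
  constructor
  · rintro ⟨u, _, hu, ⟨v, hv, rfl⟩, rfl⟩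
    exact ⟨u, v, hu, hv, rfl⟩
  · rintro ⟨u, v, hu, hv, rfl⟩
    exact ⟨u, _, hu, ⟨v, hv, rfl⟩, rfl⟩

theorem isDenselyDefinedBounded_iff {S : E →ₗ.[ℂ] F} :
    IsDenselyDefinedBounded S ↔
      Dense (S.domain : Set E) ∧ ∃ C : ℝ, 0 ≤ C ∧ ∀ x y, (x, y) ∈ S.graph → ‖y‖ ≤ C * ‖x‖ := by
  refine and_congr_right fun _ => ⟨?_, ?_⟩
  · rintro ⟨C, hC⟩
    refine ⟨max C 0, le_max_right _ _, fun x y h => ?_⟩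
    obtain ⟨hx, rfl⟩ := mem_graph_iff_exists.1 h
    exact (hC ⟨x, hx⟩).trans (by gcongr; exact le_max_left _ _)
  · rintro ⟨C, -, hC⟩
    exact ⟨C, fun x => hC _ _ (S.mem_graph x)⟩

theorem isInvOneAddSq_iff {D : E →ₗ.[ℂ] E} {R : E →L[ℂ] E} :
    IsInvOneAddSq D R ↔
      (∀ y, ∃ z, (R y, z) ∈ D.graph ∧ (z, y - R y) ∈ D.graph) ∧
        ∀ x z w, (x, z) ∈ D.graph → (z, w) ∈ D.graph → R (x + w) = x := by
  constructor
  · rintro ⟨h₁, h₂⟩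
    refine ⟨fun y => ?_, fun x z w hx hz => ?_⟩
    · obtain ⟨a, b, e⟩ := h₁ y
      exact ⟨_, mem_graph_iff_exists.2 ⟨a, rfl⟩,
        mem_graph_iff_exists.2 ⟨b, eq_sub_of_add_eq' e⟩⟩
    · obtain ⟨hx', rfl⟩ := mem_graph_iff_exists.1 hx
      obtain ⟨hz', rfl⟩ := mem_graph_iff_exists.1 hz
      exact h₂ ⟨x, hx'⟩ hz'
  · rintro ⟨h₁, h₂⟩
    refine ⟨fun y => ?_, fun x h => ?_⟩
    · obtain ⟨z, a, b⟩ := h₁ y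
      obtain ⟨a', rfl⟩ := mem_graph_iff_exists.1 a
      obtain ⟨b', e⟩ := mem_graph_iff_exists.1 b
      exact ⟨a', b', by rw [e]; abel⟩
    · exact h₂ _ _ _ (D.mem_graph x) (mem_graph_iff_exists.2 ⟨h, rfl⟩)

variable [CompleteSpace E]

/-- A densely defined operator is self-adjoint when `(x, y)` is in its graph exactly if
`⟪D u, x⟫ = ⟪u, y⟫` for all `u ∈ dom D`. -/
theorem isSelfAdjoint_iff_graph {D : E →ₗ.[ℂ] E} :
    IsSelfAdjoint D ↔ Dense (D.domain : Set E) ∧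
      ∀ x y, (x, y) ∈ D.graph ↔ ∀ u v, (u, v) ∈ D.graph → ⟪v, x⟫_ℂ = ⟪u, y⟫_ℂ := by
  constructor
  · intro h
    refine ⟨h.dense_domain, fun x y => ?_⟩
    conv_lhs => rw [← LinearPMap.isSelfAdjoint_def.1 h,
      LinearPMap.adjoint_graph_eq_graph_adjoint h.dense_domain, Submodule.mem_adjoint_iff]
    simp only [sub_eq_zero]
  · rintro ⟨hd, h⟩
    rw [LinearPMap.isSelfAdjoint_def]
    refine LinearPMap.eq_of_eq_graph (Submodule.ext ?_)
    rintro ⟨x, y⟩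
    rw [LinearPMap.adjoint_graph_eq_graph_adjoint hd, Submodule.mem_adjoint_iff, h]
    simp only [sub_eq_zero]

section SelfAdjoint

variable {D : E →ₗ.[ℂ] E}

theorem _root_.IsSelfAdjoint.mem_graph_iff (hD : IsSelfAdjoint D) {x y : E} :
    (x, y) ∈ D.graph ↔ ∀ u v, (u, v) ∈ D.graph → ⟪v, x⟫_ℂ = ⟪u, y⟫_ℂ :=
  (isSelfAdjoint_iff_graph.1 hD).2 x y

theorem _root_.IsSelfAdjoint.inner_graph (hD : IsSelfAdjoint D) {x y u v : E}
    (h : (x, y) ∈ D.graph) (h' : (u, v) ∈ D.graph) : ⟪v, x⟫_ℂ = ⟪u, y⟫_ℂ :=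
  hD.mem_graph_iff.1 h u v h'

/-- A vector `x` such that `u ↦ ⟪D u, x⟫` is bounded on `dom D` lies in the domain of a self-adjoint
operator `D`. -/
theorem _root_.IsSelfAdjoint.mem_domain_of_bound (hD : IsSelfAdjoint D) {x : E} {C : ℝ}
    (h : ∀ u v, (u, v) ∈ D.graph → ‖⟪v, x⟫_ℂ‖ ≤ C * ‖u‖) : x ∈ D.domain := by
  rw [← LinearPMap.isSelfAdjoint_def.1 hD, LinearPMap.mem_adjoint_domain_iff]
  refine AddMonoidHomClass.continuous_of_bound _ C fun u => ?_
  have := h u (D u) (D.mem_graph u)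
  rw [← inner_conj_symm, RCLike.norm_conj] at this
  exact this

theorem _root_.IsSelfAdjoint.isClosed_graph (hD : IsSelfAdjoint D) :
    IsClosed (D.graph : Set (E × E)) := hD.isClosed

end SelfAdjoint

end Graph

/-! ### The bounded operator `(I + D²)⁻¹` -/

section Resolvent

variable {E F : Type*}
  [NormedAddCommGroup E] [InnerProductSpace ℂ E]
  [NormedAddCommGroup F] [InnerProductSpace ℂ F]

section

variable {D : E →ₗ.[ℂ] E} {R : E →L[ℂ] E}

theorem IsInvOneAddSq.exists_graph (h : IsInvOneAddSq D R) (y : E) :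
    ∃ z, (R y, z) ∈ D.graph ∧ (z, y - R y) ∈ D.graph :=
  (isInvOneAddSq_iff.1 h).1 y

theorem IsInvOneAddSq.apply_eq (h : IsInvOneAddSq D R) {x z w y : E} (hx : (x, z) ∈ D.graph)
    (hz : (z, w) ∈ D.graph) (hy : x + w = y) : R y = x :=
  hy ▸ (isInvOneAddSq_iff.1 h).2 x z w hx hz

/-- A bounded operator `J` that intertwines `D₁` and `D₂` intertwines their resolvents. -/
theorem IsInvOneAddSq.intertwine {D₁ : E →ₗ.[ℂ] E} {D₂ : F →ₗ.[ℂ] F} {R₁ : E →L[ℂ] E}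
    {R₂ : F →L[ℂ] F} (h₁ : IsInvOneAddSq D₁ R₁) (h₂ : IsInvOneAddSq D₂ R₂) {J : E →L[ℂ] F}
    (hJ : ∀ x y, (x, y) ∈ D₁.graph → (J x, J y) ∈ D₂.graph) : R₂ ∘L J = J ∘L R₁ := by
  ext y
  obtain ⟨z, hz, hw⟩ := h₁.exists_graph y
  exact h₂.apply_eq (hJ _ _ hz) (hJ _ _ hw) (by simp)

theorem IsInvOneAddSq.unique {R' : E →L[ℂ] E} (h : IsInvOneAddSq D R) (h' : IsInvOneAddSq D R') :
    R = R' := by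
  simpa using h'.intertwine h (J := ContinuousLinearMap.id ℂ E) (by simp)

/-- The resolvent of `D` maps the graph of `D` into itself. -/
theorem IsInvOneAddSq.map_graph (h : IsInvOneAddSq D R) {x y : E} (hxy : (x, y) ∈ D.graph) :
    (R x, R y) ∈ D.graph := by
  obtain ⟨q, hq, hq'⟩ := h.exists_graph x
  have h₂ : (x - R x, y - q) ∈ D.graph := D.graph.sub_mem hxy hq
  rwa [h.apply_eq hq' h₂ (add_sub_cancel _ _)]

variable [CompleteSpace E]

/-- For self-adjoint `D` the operator `I + D²` has a bounded inverse: the orthogonal projection of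
`(y, 0)` onto the graph of `D` is `(x, D x)` with `x + D² x = y`. -/
theorem _root_.IsSelfAdjoint.exists_isInvOneAddSq (hD : IsSelfAdjoint D) :
    ∃ R : E →L[ℂ] E, IsInvOneAddSq D R := by
  let e := WithLp.prodContinuousLinearEquiv 2 ℂ E E
  let Γ : Submodule ℂ (WithLp 2 (E × E)) := D.graph.comap (e : WithLp 2 (E × E) →ₗ[ℂ] E × E)
  have hΓ : IsClosed (Γ : Set (WithLp 2 (E × E))) := hD.isClosed_graph.preimage e.continuous
  have : CompleteSpace Γ := hΓ.completeSpace_coe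
  let R : E →L[ℂ] E := WithLp.fstL 2 ℂ E E ∘L Γ.starProjection ∘L
    (e.symm : (E × E) →L[ℂ] WithLp 2 (E × E)) ∘L ContinuousLinearMap.inl ℂ E E
  have key : ∀ y, ∃ z, (R y, z) ∈ D.graph ∧ (z, y - R y) ∈ D.graph := by
    intro y
    set v : WithLp 2 (E × E) := WithLp.toLp 2 (y, 0)
    refine ⟨(Γ.starProjection v).snd, Γ.starProjection_apply_mem v, ?_⟩
    rw [hD.mem_graph_iff]
    intro a b hab
    have h := Γ.sub_starProjection_mem_orthogonal v
    have h' := (Submodule.mem_orthogonal _ _).1 h (WithLp.toLp 2 (a, b)) hab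
    rw [WithLp.prod_inner_apply] at h'
    simp [v, inner_sub_right] at h'
    rw [inner_sub_right]
    change _ = ⟪a, y⟫_ℂ - ⟪a, (Γ.starProjection v).fst⟫_ℂ
    linear_combination -h'
  refine ⟨R, isInvOneAddSq_iff.2 ⟨key, fun x z w hx hz => ?_⟩⟩
  -- `u = x - R (x + w)` satisfies `D² u = -u`, whence `‖u‖² + ‖D u‖² = 0`
  obtain ⟨z', h₁, h₂⟩ := key (x + w)
  have h₃ := D.graph.sub_mem hx h₁
  have h₄ := D.graph.sub_mem hz h₂
  have h₅ := hD.inner_graph h₃ h₄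
  have h₆ : w - (x + w - R (x + w)) = -(x - R (x + w)) := by abel
  simp only [h₆, inner_neg_left, inner_self_eq_norm_sq_to_K] at h₅
  have h₇ : ‖x - R (x + w)‖ ^ 2 + ‖z - z'‖ ^ 2 = 0 := by
    have h₈ := congrArg Complex.re h₅
    simp only [Complex.coe_algebraMap, ← Complex.ofReal_pow, ← Complex.ofReal_neg,
      Complex.ofReal_re] at h₈
    linarith
  have h₈ : ‖x - R (x + w)‖ = 0 := by nlinarith [sq_nonneg ‖x - R (x + w)‖, sq_nonneg ‖z - z'‖]
  exact (sub_eq_zero.1 (norm_eq_zero.1 h₈)).symm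

theorem IsInvOneAddSq.isSelfAdjoint (hD : IsSelfAdjoint D) (h : IsInvOneAddSq D R) :
    IsSelfAdjoint R := by
  rw [ContinuousLinearMap.isSelfAdjoint_iff_isSymmetric]
  intro x y
  obtain ⟨z, hz, hz'⟩ := h.exists_graph x
  obtain ⟨w, hw, hw'⟩ := h.exists_graph y
  have h₃ := hD.inner_graph hw hz'
  simp only [inner_sub_left] at h₃
  change ⟪R x, y⟫_ℂ = ⟪x, R y⟫_ℂ
  have h₄ := hD.inner_graph hw' hz
  simp only [inner_sub_right] at h₄
  linear_combination -h₃ - h₄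

/-- The quadratic form of the resolvent is the square of the graph norm of `R x`. -/
theorem IsInvOneAddSq.inner_apply_self (hD : IsSelfAdjoint D) (h : IsInvOneAddSq D R) {x z : E}
    (hz : (R x, z) ∈ D.graph) : ⟪R x, x⟫_ℂ = ((‖R x‖ ^ 2 + ‖z‖ ^ 2 : ℝ) : ℂ) := by
  obtain ⟨z', h₁, h₂⟩ := h.exists_graph x
  obtain rfl : z' = z := LinearPMap.mem_graph_snd_inj _ h₁ hz rfl
  have := hD.inner_graph h₂ hz
  rw [inner_sub_right, inner_self_eq_norm_sq_to_K, inner_self_eq_norm_sq_to_K] at this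
  push_cast
  linear_combination -this

theorem IsInvOneAddSq.nonneg (hD : IsSelfAdjoint D) (h : IsInvOneAddSq D R) : 0 ≤ R := by
  rw [ContinuousLinearMap.nonneg_iff_isPositive, ContinuousLinearMap.isPositive_iff]
  refine ⟨(ContinuousLinearMap.isSelfAdjoint_iff_isSymmetric.1 (h.isSelfAdjoint hD)), fun x => ?_⟩
  obtain ⟨z, hz, -⟩ := h.exists_graph x
  rw [h.inner_apply_self hD hz]
  exact_mod_cast by positivity

/-- If `dom D₂ ⊆ dom D₁` and `‖D₁ x‖ ≤ c ‖D₂ x‖`, then `(I + D₂²)⁻¹` is at most a multiple of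
`(I + D₁²)⁻¹`. -/
theorem IsInvOneAddSq.le_smul {D₁ D₂ : E →ₗ.[ℂ] E} {R₁ R₂ : E →L[ℂ] E} (hD₁ : IsSelfAdjoint D₁)
    (hD₂ : IsSelfAdjoint D₂) (h₁ : IsInvOneAddSq D₁ R₁) (h₂ : IsInvOneAddSq D₂ R₂) {c : ℝ}
    (hc : ∀ x z, (x, z) ∈ D₂.graph → ∃ w, (x, w) ∈ D₁.graph ∧ ‖w‖ ≤ c * ‖z‖) :
    R₂ ≤ (1 + c ^ 2) • R₁ := by
  rw [ContinuousLinearMap.le_def, ContinuousLinearMap.isPositive_iff]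
  constructor
  · exact ContinuousLinearMap.isSelfAdjoint_iff_isSymmetric.1
      (((IsSelfAdjoint.all (1 + c ^ 2)).smul (h₁.isSelfAdjoint hD₁)).sub (h₂.isSelfAdjoint hD₂))
  intro y
  obtain ⟨z, hz, hz'⟩ := h₂.exists_graph y
  obtain ⟨w, hw, hwz⟩ := hc _ _ hz
  obtain ⟨v, hv, hv'⟩ := h₁.exists_graph y
  have e₂ := h₂.inner_apply_self hD₂ hz
  have e₁ := h₁.inner_apply_self hD₁ hv
  have hb : ⟪R₂ y, y⟫_ℂ = ⟪R₂ y, R₁ y⟫_ℂ + ⟪w, v⟫_ℂ := by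
    rw [hD₁.inner_graph hv' hw, inner_sub_right]; ring
  set q₂ := ‖R₂ y‖ ^ 2 + ‖z‖ ^ 2
  set q₁ := ‖R₁ y‖ ^ 2 + ‖v‖ ^ 2
  have hq : q₂ ≤ ‖R₂ y‖ * ‖R₁ y‖ + ‖w‖ * ‖v‖ := by
    have : q₂ = ‖⟪R₂ y, y⟫_ℂ‖ := by
      rw [e₂, Complex.norm_real, Real.norm_of_nonneg (by positivity)]
    rw [this, hb]
    exact (norm_add_le _ _).trans (add_le_add (norm_inner_le_norm _ _) (norm_inner_le_norm _ _))
  have hw2 : ‖w‖ ^ 2 ≤ c ^ 2 * ‖z‖ ^ 2 := by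
    rw [← mul_pow]; exact pow_le_pow_left₀ (norm_nonneg _) hwz 2
  -- Cauchy–Schwarz in the graph norm of `D₁`
  have hmain : q₂ ≤ (1 + c ^ 2) * q₁ := by
    have hA : ‖R₂ y‖ ^ 2 + ‖w‖ ^ 2 ≤ (1 + c ^ 2) * q₂ := by
      simp only [q₂]
      nlinarith [sq_nonneg ‖z‖, mul_nonneg (sq_nonneg c) (sq_nonneg ‖R₂ y‖)]
    have hB : (‖R₂ y‖ * ‖R₁ y‖ + ‖w‖ * ‖v‖) ^ 2 ≤ (‖R₂ y‖ ^ 2 + ‖w‖ ^ 2) * q₁ := by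
      simp only [q₁]
      nlinarith [sq_nonneg (‖R₂ y‖ * ‖v‖ - ‖w‖ * ‖R₁ y‖)]
    have hq₂ : 0 ≤ q₂ := by positivity
    have hq₁ : 0 ≤ q₁ := by positivity
    have hC : q₂ ^ 2 ≤ ((1 + c ^ 2) * q₁) * q₂ := by
      calc q₂ ^ 2 ≤ _ := pow_le_pow_left₀ hq₂ hq 2
        _ ≤ _ := hB
        _ ≤ (1 + c ^ 2) * q₂ * q₁ := by gcongr
        _ = _ := by ring
    rcases hq₂.eq_or_lt with h0 | h0
    · rw [← h0]; positivity
    · rw [sq] at hC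
      exact le_of_mul_le_mul_right hC h0
  have : ⟪((1 + c ^ 2) • R₁ - R₂) y, y⟫_ℂ = (((1 + c ^ 2) * q₁ - q₂ : ℝ) : ℂ) := by
    have hsm : ((1 + c ^ 2) • R₁ - R₂) y = ((1 + c ^ 2 : ℝ) : ℂ) • R₁ y - R₂ y := by
      rw [Complex.coe_smul]; rfl
    rw [hsm, inner_sub_left, e₂, inner_smul_left, Complex.conj_ofReal, e₁]
    push_cast
    ring
  rw [this]
  exact_mod_cast sub_nonneg.2 hmain

end

/-! ### The product of a self-adjoint operator and an invertible operator commuting with it -/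

section Perturb

variable [CompleteSpace E] {D : E →ₗ.[ℂ] E} {B B' : E →L[ℂ] E}

/-- If a bounded self-adjoint `B` and its inverse `B'` map the graph of the self-adjoint operator
`D` into itself, then `B D` is self-adjoint. -/
theorem isSelfAdjoint_boundedMul (hD : IsSelfAdjoint D) (hB : IsSelfAdjoint B)
    (hBD : ∀ x y, (x, y) ∈ D.graph → (B x, B y) ∈ D.graph)
    (hBD' : ∀ x y, (x, y) ∈ D.graph → (B' x, B' y) ∈ D.graph)
    (hinv : B' * B = 1) : IsSelfAdjoint (boundedMul B D) := by
  have hs : ∀ x y, ⟪B x, y⟫_ℂ = ⟪x, B y⟫_ℂ :=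
    ContinuousLinearMap.isSelfAdjoint_iff_isSymmetric.1 hB
  have hi : ∀ x, B' (B x) = x := fun x => DFunLike.congr_fun hinv x
  rw [isSelfAdjoint_iff_graph]
  refine ⟨hD.dense_domain, fun x y => ?_⟩
  simp only [mem_graph_boundedMul]
  constructor
  · rintro ⟨z, hz, rfl⟩ u _ ⟨w, hw, rfl⟩
    rw [hs]
    exact hD.inner_graph (hBD _ _ hz) hw
  · intro h
    have h₁ : (B x, y) ∈ D.graph := by
      rw [hD.mem_graph_iff]
      intro u v huv
      rw [← hs]
      exact h _ _ ⟨v, huv, rfl⟩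
    have h₂ := hBD' _ _ h₁
    rw [hi] at h₂
    refine ⟨_, h₂, ?_⟩
    exact LinearPMap.mem_graph_snd_inj _ h₁ (hBD _ _ h₂) rfl

omit [CompleteSpace E] in
/-- The resolvent of `B D` is the product of the resolvent of `D` and a bounded operator. -/
theorem IsInvOneAddSq.boundedMul_eq {R S : E →L[ℂ] E}
    (hBD' : ∀ x y, (x, y) ∈ D.graph → (B' x, B' y) ∈ D.graph)
    (hinv : B' * B = 1) (hR : IsInvOneAddSq D R) (hS : IsInvOneAddSq (boundedMul B D) S) :
    S = R ∘L (S + B' * B' * (1 - S)) := by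
  have hi : ∀ x, B' (B x) = x := fun x => DFunLike.congr_fun hinv x
  ext y
  obtain ⟨z, hz, hz'⟩ := hS.exists_graph y
  obtain ⟨z₁, h₁, rfl⟩ := mem_graph_boundedMul.1 hz
  obtain ⟨z₂, h₂, e⟩ := mem_graph_boundedMul.1 hz'
  have h₃ := hBD' _ _ h₂
  rw [hi] at h₃
  refine (hR.apply_eq h₁ h₃ ?_).symm
  change S y + B' z₂ = S y + B' (B' (y - S y))
  rw [e, hi]

end Perturb

end Resolvent

/-! ### Powers of positive operators -/

section Powers

variable {E F : Type*}
  [NormedAddCommGroup E] [InnerProductSpace ℂ E] [CompleteSpace E]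
  [NormedAddCommGroup F] [InnerProductSpace ℂ F] [CompleteSpace F]

/-- Pairs `(S, T)` of operators such that `J` intertwines `T` with `S` and `T†` with `S†`. -/
def intertwiners (J : E →L[ℂ] F) : StarSubalgebra ℂ ((F →L[ℂ] F) × (E →L[ℂ] E)) where
  carrier := {p | p.1 ∘L J = J ∘L p.2 ∧ star p.1 ∘L J = J ∘L star p.2}
  mul_mem' := by
    rintro ⟨S, T⟩ ⟨S', T'⟩ ⟨h₁, h₂⟩ ⟨h₁', h₂'⟩
    dsimp only at h₁ h₂ h₁' h₂'
    constructor
    · change (S ∘L S') ∘L J = J ∘L (T ∘L T')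
      rw [ContinuousLinearMap.comp_assoc, h₁', ← ContinuousLinearMap.comp_assoc, h₁,
        ContinuousLinearMap.comp_assoc]
    · change star (S * S') ∘L J = J ∘L star (T * T')
      rw [star_mul, star_mul]
      change (star S' ∘L star S) ∘L J = J ∘L (star T' ∘L star T)
      rw [ContinuousLinearMap.comp_assoc, h₂, ← ContinuousLinearMap.comp_assoc, h₂',
        ContinuousLinearMap.comp_assoc]
  add_mem' := by
    rintro ⟨S, T⟩ ⟨S', T'⟩ ⟨h₁, h₂⟩ ⟨h₁', h₂'⟩
    dsimp only at h₁ h₂ h₁' h₂'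
    constructor
    · change (S + S') ∘L J = J ∘L (T + T')
      rw [ContinuousLinearMap.add_comp, ContinuousLinearMap.comp_add, h₁, h₁']
    · change star (S + S') ∘L J = J ∘L star (T + T')
      rw [star_add, star_add, ContinuousLinearMap.add_comp, ContinuousLinearMap.comp_add, h₂, h₂']
  algebraMap_mem' := by
    intro c
    constructor
    · ext x
      change c • J x = J (c • x)
      rw [map_smul]
    · rw [← Prod.fst_star, ← Prod.snd_star, ← algebraMap_star_comm]
      ext x
      change star c • J x = J (star c • x)
      rw [map_smul]
  star_mem' := by
    rintro ⟨S, T⟩ ⟨h₁, h₂⟩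
    refine ⟨h₂, ?_⟩
    simpa using! h₁

instance isClosed_intertwiners (J : E →L[ℂ] F) :
    IsClosed (intertwiners J : Set ((F →L[ℂ] F) × (E →L[ℂ] E))) := by
  refine IsClosed.inter ?_ ?_
  · exact isClosed_eq (continuous_fst.clm_comp continuous_const)
      (continuous_const.clm_comp continuous_snd)
  · exact isClosed_eq ((continuous_star.comp continuous_fst).clm_comp continuous_const)
      (continuous_const.clm_comp (continuous_star.comp continuous_snd))

/-- The continuous functional calculus of a pair in a closed star-subalgebra of a product, computed
componentwise, stays in the subalgebra. -/
theorem cfc_prodMk_mem {A B : Type*} [CStarAlgebra A] [CStarAlgebra B]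
    (s : StarSubalgebra ℂ (A × B)) [IsClosed (s : Set (A × B))] {a : A} {b : B}
    (ha : IsSelfAdjoint a) (hb : IsSelfAdjoint b) (hab : (a, b) ∈ s) {f : ℝ → ℝ}
    (hf : Continuous f) : (cfc f a, cfc f b) ∈ s := by
  -- the complex calculus is used, since `s` is an algebra over `ℂ`
  have h : IsSelfAdjoint (a, b) := Prod.ext ha.star_eq hb.star_eq
  rw [cfc_real_eq_complex f ha, cfc_real_eq_complex f hb,
    ← cfc_map_prod (S := ℂ) (fun x : ℂ => ((f x.re : ℝ) : ℂ)) a b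
      (Complex.continuous_ofReal.comp (hf.comp Complex.continuous_re)).continuousOn
      h.isStarNormal ha.isStarNormal hb.isStarNormal]
  exact cfc_mem (𝕜' := ℂ) _ hab

/-- An operator intertwining two positive operators intertwines their powers. -/
theorem rpow_intertwine {J : E →L[ℂ] F} {S : F →L[ℂ] F} {T : E →L[ℂ] E} (hS : 0 ≤ S) (hT : 0 ≤ T)
    (h : S ∘L J = J ∘L T) {p : ℝ} (hp : 0 ≤ p) : (S ^ p) ∘L J = J ∘L (T ^ p) := by
  have hS' : IsSelfAdjoint S := .of_nonneg hS
  have hT' : IsSelfAdjoint T := .of_nonneg hT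
  have hmem : (S, T) ∈ intertwiners J :=
    ⟨h, by dsimp only; rw [hS'.star_eq, hT'.star_eq]; exact h⟩
  rw [CFC.rpow_eq_cfc_real hS, CFC.rpow_eq_cfc_real hT]
  exact (cfc_prodMk_mem (intertwiners J) hS' hT' hmem (Real.continuous_rpow_const hp)).1

theorem pow_le_pow_of_commute {A B : E →L[ℂ] E} (hA : 0 ≤ A) (hAB : Commute A B) (h : A ≤ B)
    (n : ℕ) : A ^ n ≤ B ^ n := by
  have hB : 0 ≤ B := hA.trans h
  induction n with
  | zero => simp
  | succ n ih =>
    have h₁ : 0 ≤ (B ^ n - A ^ n) * B :=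
      Commute.mul_nonneg (sub_nonneg.2 ih) hB
        (((Commute.refl B).pow_left n).sub_left (hAB.pow_left n))
    have h₂ : 0 ≤ A ^ n * (B - A) :=
      Commute.mul_nonneg (CStarAlgebra.pow_nonneg hA n) (sub_nonneg.2 h)
        ((hAB.pow_left n).sub_right ((Commute.refl A).pow_left n))
    have h₃ : B ^ (n + 1) - A ^ (n + 1) = (B ^ n - A ^ n) * B + A ^ n * (B - A) := by
      rw [pow_succ, pow_succ, sub_mul, mul_sub]; abel
    rw [← sub_nonneg, h₃]
    exact add_nonneg h₁ h₂

/-- Powers with arbitrary nonnegative exponents are monotone on commuting positive operators: the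
operator monotone powers with exponent at most `1` are combined with integral powers. -/
theorem rpow_le_rpow_of_commute {A B : E →L[ℂ] E} (hA : 0 ≤ A) (hAB : Commute A B) (h : A ≤ B)
    {p : ℝ} (hp : 0 ≤ p) : A ^ p ≤ B ^ p := by
  have hB : 0 ≤ B := hA.trans h
  obtain ⟨n, hn⟩ := exists_nat_ge (max p 1)
  have hn1 : (0 : ℝ) < n := zero_lt_one.trans_le ((le_max_right _ _).trans hn)
  have hpn : p = n * (p / n) := by field_simp
  have ht : p / n ∈ Set.Icc (0 : ℝ) 1 :=
    ⟨by positivity, by rw [div_le_one hn1]; exact (le_max_left _ _).trans hn⟩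
  rw [hpn, ← CFC.rpow_rpow_of_exponent_nonneg A n (p / n) hn1.le ht.1 hA,
    ← CFC.rpow_rpow_of_exponent_nonneg B n (p / n) hn1.le ht.1 hB,
    CFC.rpow_natCast A n hA, CFC.rpow_natCast B n hB]
  exact CFC.rpow_le_rpow ht (pow_le_pow_of_commute hA hAB h n)

theorem smul_rpow {B : E →L[ℂ] E} (hB : 0 ≤ B) (c : NNReal) {p : ℝ} (hp : 0 ≤ p) :
    (c • B) ^ p = (c ^ p) • B ^ p := by
  have hcont : Continuous fun x : NNReal => x ^ p := NNReal.continuous_rpow_const hp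
  rw [CFC.rpow_def, CFC.rpow_def, ← cfc_comp_const_mul c _ B hcont.continuousOn hB]
  simp only [NNReal.mul_rpow]
  exact cfc_const_mul _ _ _ hcont.continuousOn

theorem rpow_le_smul_rpow_of_commute {A B : E →L[ℂ] E} (hA : 0 ≤ A) (hB : 0 ≤ B)
    (hAB : Commute A B) {c : ℝ} (hc : 0 ≤ c) (h : A ≤ c • B) {p : ℝ} (hp : 0 ≤ p) :
    A ^ p ≤ (c ^ p) • B ^ p := by
  lift c to NNReal using hc
  have h₁ := rpow_le_rpow_of_commute (B := c • B) hA (hAB.smul_right c) h hp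
  rwa [smul_rpow hB c hp] at h₁

end Powers

/-! ### The trace class -/

section Trace

variable {E F : Type*}
  [NormedAddCommGroup E] [InnerProductSpace ℂ E] [CompleteSpace E]
  [NormedAddCommGroup F] [InnerProductSpace ℂ F] [CompleteSpace F]

open scoped ENNReal

omit [CompleteSpace E] in
/-- Parseval's identity. -/
theorem tsum_ofReal_norm_inner_sq {ι : Type*} (b : HilbertBasis ι ℂ E) (x : E) :
    ∑' i, ENNReal.ofReal (‖⟪b i, x⟫_ℂ‖ ^ 2) = ENNReal.ofReal (‖x‖ ^ 2) := by
  have h := b.hasSum_inner_mul_inner x x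
  have h' : HasSum (fun i => ‖⟪b i, x⟫_ℂ‖ ^ 2) (‖x‖ ^ 2) := by
    have hs : (fun i => ⟪x, b i⟫_ℂ * ⟪b i, x⟫_ℂ) = fun i => ((‖⟪b i, x⟫_ℂ‖ ^ 2 : ℝ) : ℂ) := by
      ext i
      rw [← inner_conj_symm x, Complex.conj_mul']
      push_cast
      rfl
    have hx : ⟪x, x⟫_ℂ = ((‖x‖ ^ 2 : ℝ) : ℂ) := by
      rw [inner_self_eq_norm_sq_to_K]; norm_cast
    rw [hx, hs] at h
    exact Complex.hasSum_ofReal.1 h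
  rw [← ENNReal.ofReal_tsum_of_nonneg (fun _ => by positivity) h'.summable, h'.tsum_eq]

/-- The Hilbert–Schmidt norm does not depend on the basis and is the same for `X` and `X†`. -/
theorem tsum_norm_sq_adjoint {ι κ : Type*} (b : HilbertBasis ι ℂ E) (c : HilbertBasis κ ℂ F)
    (X : E →L[ℂ] F) :
    ∑' i, ENNReal.ofReal (‖X (b i)‖ ^ 2) =
      ∑' j, ENNReal.ofReal (‖ContinuousLinearMap.adjoint X (c j)‖ ^ 2) := by
  simp_rw [← tsum_ofReal_norm_inner_sq c, ← tsum_ofReal_norm_inner_sq b]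
  rw [ENNReal.tsum_comm]
  refine tsum_congr fun j => tsum_congr fun i => ?_
  rw [ContinuousLinearMap.adjoint_inner_right, norm_inner_symm]

theorem re_inner_eq_norm_sqrt_sq {T : E →L[ℂ] E} (hT : 0 ≤ T) (x : E) :
    (⟪x, T x⟫_ℂ).re = ‖CFC.sqrt T x‖ ^ 2 := by
  have h₁ : T x = CFC.sqrt T (CFC.sqrt T x) := by
    conv_lhs => rw [← CFC.sqrt_mul_sqrt_self T hT]
    rfl
  have h₂ : IsSelfAdjoint (CFC.sqrt T) := .of_nonneg (CFC.sqrt_nonneg T)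
  have h₃ : ⟪x, T x⟫_ℂ = ⟪CFC.sqrt T x, CFC.sqrt T x⟫_ℂ := by
    rw [h₁]
    exact (ContinuousLinearMap.isSelfAdjoint_iff_isSymmetric.1 h₂ _ _).symm
  rw [h₃, inner_self_eq_norm_sq_to_K]
  norm_cast

theorem re_inner_nonneg {T : E →L[ℂ] E} (hT : 0 ≤ T) (x : E) : 0 ≤ (⟪x, T x⟫_ℂ).re := by
  rw [re_inner_eq_norm_sqrt_sq hT]
  positivity

/-- If the trace of the positive operator `T` is finite in some basis, then the trace of `J† T J` is
finite in every basis. -/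
theorem summable_inner_of_isTraceClass {T : F →L[ℂ] F} (hT : 0 ≤ T) (h : IsTraceClass T)
    (J : E →L[ℂ] F) {ι : Type*} (b : HilbertBasis ι ℂ E) :
    Summable fun i => (⟪J (b i), T (J (b i))⟫_ℂ).re := by
  obtain ⟨κ, c, hc⟩ := h
  rw [CFC.abs_of_nonneg T hT] at hc
  simp_rw [re_inner_eq_norm_sqrt_sq hT] at hc ⊢
  have hfin : ∑' j, ENNReal.ofReal (‖CFC.sqrt T (c j)‖ ^ 2) ≠ ∞ :=
    hc.tsum_ofReal_ne_top
  have h₁ := tsum_norm_sq_adjoint b c (CFC.sqrt T ∘L J)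
  have hs : ContinuousLinearMap.adjoint (CFC.sqrt T) = CFC.sqrt T :=
    (IsSelfAdjoint.of_nonneg (CFC.sqrt_nonneg T)).star_eq
  rw [ContinuousLinearMap.adjoint_comp, hs] at h₁
  have h₂ : ∑' i, ENNReal.ofReal (‖(CFC.sqrt T ∘L J) (b i)‖ ^ 2) ≠ ∞ := by
    rw [h₁]
    refine ne_top_of_le_ne_top
      (ENNReal.mul_ne_top
        (ENNReal.ofReal_ne_top (r := ‖ContinuousLinearMap.adjoint J‖ ^ 2)) hfin) ?_
    rw [← ENNReal.tsum_mul_left]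
    refine ENNReal.tsum_le_tsum fun j => ?_
    rw [← ENNReal.ofReal_mul (by positivity), ← mul_pow]
    refine ENNReal.ofReal_le_ofReal (pow_le_pow_left₀ (norm_nonneg _) ?_ 2)
    exact (ContinuousLinearMap.adjoint J).le_opNorm (CFC.sqrt T (c j))
  have h₃ := ENNReal.summable_toReal h₂
  simpa [ENNReal.toReal_ofReal] using h₃

theorem isTraceClass_of_summable {T : E →L[ℂ] E} (hT : 0 ≤ T)
    (h : ∀ (ι : Set E) (b : HilbertBasis ι ℂ E), Summable fun i => (⟪b i, T (b i)⟫_ℂ).re) :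
    IsTraceClass T := by
  obtain ⟨ι, b, -⟩ := exists_hilbertBasis ℂ E
  refine ⟨ι, b, ?_⟩
  rw [CFC.abs_of_nonneg T hT]
  exact h ι b

theorem IsTraceClass.of_le_smul {S T : E →L[ℂ] E} (hS : 0 ≤ S) (hT : 0 ≤ T) (h : IsTraceClass T)
    {c : ℝ} (hST : S ≤ c • T) : IsTraceClass S := by
  refine isTraceClass_of_summable hS fun ι b => ?_
  refine .of_nonneg_of_le (fun i => re_inner_nonneg hS _) (fun i => ?_)
    ((summable_inner_of_isTraceClass hT h (ContinuousLinearMap.id ℂ E) b).mul_left c)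
  have h₁ := re_inner_nonneg (sub_nonneg.2 hST) (b i)
  have h₂ : (c • T - S) (b i) = (c : ℂ) • T (b i) - S (b i) := by
    rw [Complex.coe_smul]; rfl
  rw [h₂, inner_sub_right, inner_smul_right, Complex.sub_re, Complex.re_ofReal_mul] at h₁
  simpa using h₁

end Trace

/-! ### Compact operators on Hilbert spaces -/

section Compact

variable {E F : Type*}
  [NormedAddCommGroup E] [InnerProductSpace ℂ E]
  [NormedAddCommGroup F] [InnerProductSpace ℂ F]

theorem isCompactOperator_starProjection (U : Submodule ℂ F) [FiniteDimensional ℂ U] :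
    IsCompactOperator U.starProjection :=
  have : LocallyCompactSpace U := have := FiniteDimensional.proper ℂ U; inferInstance
  ((isCompactOperator_id (E := U)).comp_clm U.orthogonalProjectionOnto).clm_comp U.subtypeL

/-- A compact operator is approximated in norm by its compositions with orthogonal projections onto
finite-dimensional subspaces of a given dense subspace: these are spanned by approximations to the
points of a finite net of the image of the unit ball. -/
theorem exists_norm_sub_starProjection_comp_le {k : E →L[ℂ] F} (hk : IsCompactOperator k)
    (S : Submodule ℂ F) (hS : Dense (S : Set F)) {ε : ℝ} (hε : 0 < ε) :
    ∃ (U : Submodule ℂ F) (_ : FiniteDimensional ℂ U), U ≤ S ∧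
      ‖k - U.starProjection ∘L k‖ ≤ ε := by
  obtain ⟨K, hK, hkK⟩ := hk.image_closedBall_subset_compact (f := (k : E →ₗ[ℂ] F)) 1
  obtain ⟨t, htf, ht⟩ := Metric.totallyBounded_iff.1 hK.totallyBounded (ε / 2) (half_pos hε)
  have hs : ∀ y : F, ∃ s ∈ S, dist y s < ε / 2 := fun y =>
    Metric.mem_closure_iff.1 (hS y) _ (half_pos hε)
  choose s hsS hs using hs
  have hfin : FiniteDimensional ℂ (Submodule.span ℂ (s '' t)) :=
    FiniteDimensional.span_of_finite ℂ (htf.image s)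
  refine ⟨Submodule.span ℂ (s '' t), hfin, ?_, ?_⟩
  · rw [Submodule.span_le]
    rintro _ ⟨y, -, rfl⟩
    exact hsS y
  · refine ContinuousLinearMap.opNorm_le_of_unit_norm hε.le fun x hx => ?_
    have hxK : k x ∈ K := hkK ⟨x, by simp [hx], rfl⟩
    obtain ⟨y, hy, hxy⟩ := Set.mem_iUnion₂.1 (ht hxK)
    have hmem : s y ∈ Submodule.span ℂ (s '' t) := Submodule.subset_span ⟨y, hy, rfl⟩
    have hmin := Submodule.starProjection_minimal (U := Submodule.span ℂ (s '' t)) (k x)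
    calc ‖k x - (Submodule.span ℂ (s '' t)).starProjection (k x)‖ ≤ ‖k x - s y‖ := by
          rw [hmin]
          exact ciInf_le ⟨0, by rintro _ ⟨z, rfl⟩; exact norm_nonneg _⟩
            (⟨s y, hmem⟩ : Submodule.span ℂ (s '' t))
      _ = dist (k x) (s y) := (dist_eq_norm _ _).symm
      _ ≤ dist (k x) y + dist y (s y) := dist_triangle _ _ _
      _ ≤ ε := by linarith [Metric.mem_ball.1 hxy, hs y]

variable [CompleteSpace E] [CompleteSpace F]

theorem norm_adjoint_sub (S T : E →L[ℂ] F) :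
    ‖ContinuousLinearMap.adjoint S - ContinuousLinearMap.adjoint T‖ = ‖S - T‖ := by
  rw [← map_sub]
  exact (ContinuousLinearMap.adjoint (𝕜 := ℂ) (E := E) (F := F)).norm_map _

theorem adjoint_starProjection_comp (U : Submodule ℂ F) [CompleteSpace U] (k : E →L[ℂ] F) :
    ContinuousLinearMap.adjoint (U.starProjection ∘L k) =
      ContinuousLinearMap.adjoint k ∘L U.starProjection := by
  rw [ContinuousLinearMap.adjoint_comp]
  congr 1
  exact isSelfAdjoint_starProjection U

theorem _root_.IsCompactOperator.adjoint {k : E →L[ℂ] F} (hk : IsCompactOperator k) :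
    IsCompactOperator (ContinuousLinearMap.adjoint k) := by
  have hcl : IsClosed {f : F →L[ℂ] E | IsCompactOperator f} :=
    isClosed_setOfPred_isCompactOperator (σ₁₂ := RingHom.id ℂ)
  refine hcl.closure_subset (Metric.mem_closure_iff.2 fun ε hε => ?_)
  obtain ⟨U, hU, -, h⟩ :=
    exists_norm_sub_starProjection_comp_le hk ⊤ (by simp) (half_pos hε)
  refine ⟨ContinuousLinearMap.adjoint (U.starProjection ∘L k), ?_, ?_⟩
  · rw [adjoint_starProjection_comp]
    exact (isCompactOperator_starProjection U).clm_comp (ContinuousLinearMap.adjoint k)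
  · rw [dist_eq_norm, norm_adjoint_sub]
    linarith

/-- A compact operator is approximated by its compressions to finite-dimensional subspaces of a
given dense subspace. -/
theorem exists_norm_sub_starProjection_conj_lt {k : E →L[ℂ] E} (hk : IsCompactOperator k)
    (S : Submodule ℂ E) (hS : Dense (S : Set E)) {ε : ℝ} (hε : 0 < ε) :
    ∃ (U V : Submodule ℂ E) (_ : FiniteDimensional ℂ U) (_ : FiniteDimensional ℂ V),
      U ≤ S ∧ V ≤ S ∧ ‖k - U.starProjection ∘L k ∘L V.starProjection‖ < ε := by
  obtain ⟨U, hU, hUS, h₁⟩ :=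
    exists_norm_sub_starProjection_comp_le hk S hS (ε := ε / 3) (by positivity)
  have hk₁ : IsCompactOperator (U.starProjection ∘L k) :=
    hk.clm_comp U.starProjection
  obtain ⟨V, hV, hVS, h₂⟩ :=
    exists_norm_sub_starProjection_comp_le hk₁.adjoint S hS (ε := ε / 3) (by positivity)
  refine ⟨U, V, hU, hV, hUS, hVS, ?_⟩
  have h₃ : ContinuousLinearMap.adjoint
      (V.starProjection ∘L ContinuousLinearMap.adjoint (U.starProjection ∘L k)) =
      U.starProjection ∘L k ∘L V.starProjection := by
    rw [adjoint_starProjection_comp, ContinuousLinearMap.adjoint_adjoint,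
      ContinuousLinearMap.comp_assoc]
  rw [← norm_adjoint_sub, ContinuousLinearMap.adjoint_adjoint, h₃] at h₂
  calc _ = ‖(k - U.starProjection ∘L k) +
        (U.starProjection ∘L k - U.starProjection ∘L k ∘L V.starProjection)‖ := by
        congr 1; abel
    _ ≤ ε / 3 + ε / 3 := (norm_add_le _ _).trans (add_le_add h₁ h₂)
    _ < ε := by linarith

end Compact

/-! ### The Toeplitz extension and its quotient map -/

section Extension

variable {H : Type*} [NormedAddCommGroup H] [InnerProductSpace ℂ H]
  (M : Submodule ℂ H) [CompleteSpace M]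

theorem compress_apply (a : H →L[ℂ] H) (x : M) :
    compress M a x = M.orthogonalProjectionOnto (a x) := rfl

theorem compress_add (a b : H →L[ℂ] H) : compress M (a + b) = compress M a + compress M b := by
  ext x; simp [compress_apply]

theorem compress_sub (a b : H →L[ℂ] H) : compress M (a - b) = compress M a - compress M b := by
  ext x; simp [compress_apply]

theorem compress_smul (c : ℂ) (a : H →L[ℂ] H) : compress M (c • a) = c • compress M a := by
  ext x; simp [compress_apply]

theorem compress_zero : compress M (0 : H →L[ℂ] H) = 0 := by
  ext x; simp [compress_apply]

theorem compress_one : compress M 1 = 1 := by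
  ext x; simp [compress_apply]

theorem norm_compress_le (a : H →L[ℂ] H) : ‖compress M a‖ ≤ ‖a‖ := by
  refine ContinuousLinearMap.opNorm_le_bound _ (norm_nonneg _) fun x => ?_
  calc ‖compress M a x‖ = ‖M.starProjection (a x)‖ := rfl
    _ ≤ ‖a x‖ := M.norm_starProjection_apply_le _
    _ ≤ ‖a‖ * ‖(x : H)‖ := a.le_opNorm _

theorem continuous_compress : Continuous (compress M) := by
  unfold compress
  exact continuous_const.clm_comp (continuous_id.clm_comp continuous_const)

/-- The defect of multiplicativity of the compression, in terms of `[P, a]`. -/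
theorem compress_mul_sub (a b : H →L[ℂ] H) :
    compress M (a * b) - compress M a * compress M b =
      M.orthogonalProjectionOnto ∘L (M.starProjection * a - a * M.starProjection) ∘L
        (1 - M.starProjection) ∘L b ∘L M.subtypeL := by
  ext x
  have h : ∀ y, M.starProjection (M.starProjection y) = M.starProjection y := fun y =>
    M.starProjection_mem_subspace_eq_self (M.orthogonalProjectionOnto y)
  change M.starProjection (a (b x)) - M.starProjection (a (M.starProjection (b x))) =
    M.starProjection (M.starProjection (a (b x - M.starProjection (b x))) -
      a (M.starProjection (b x - M.starProjection (b x))))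
  simp [h]

variable [CompleteSpace H]

theorem compress_adjoint (a : H →L[ℂ] H) :
    ContinuousLinearMap.adjoint (compress M a) = compress M (ContinuousLinearMap.adjoint a) := by
  rw [compress, ContinuousLinearMap.adjoint_comp, ContinuousLinearMap.adjoint_comp,
    Submodule.adjoint_orthogonalProjectionOnto, Submodule.adjoint_subtypeL]
  rfl

variable {M} {𝓐 : StarSubalgebra ℂ (H →L[ℂ] H)}

omit [CompleteSpace H] in
theorem isCompactOperator_compress_mul_sub {a : H →L[ℂ] H}
    (ha : IsCompactOperator (M.starProjection * a - a * M.starProjection : H →L[ℂ] H))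
    (b : H →L[ℂ] H) :
    IsCompactOperator (compress M (a * b) - compress M a * compress M b : M →L[ℂ] M) := by
  rw [compress_mul_sub]
  exact (ha.comp_clm ((1 - M.starProjection) ∘L b ∘L M.subtypeL)).clm_comp
    M.orthogonalProjectionOnto

/-- The pairs `(a, t)` with `t - T(a)` compact: the pullback of `φ` and of the quotient map of the
Calkin algebra. -/
def toeplitzPairs
    (h : ∀ a ∈ 𝓐, IsCompactOperator (M.starProjection * a - a * M.starProjection : H →L[ℂ] H)) :
    StarSubalgebra ℂ (𝓐 × (M →L[ℂ] M)) where
  carrier := {p | IsCompactOperator (p.2 - compress M (p.1 : H →L[ℂ] H) : M →L[ℂ] M)}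
  mul_mem' := by
    rintro ⟨a, s⟩ ⟨b, t⟩ hs ht
    have h₁ := isCompactOperator_compress_mul_sub (h a a.2) (b : H →L[ℂ] H)
    have h₂ : IsCompactOperator ((s - compress M (a : H →L[ℂ] H)) ∘L t) := hs.comp_clm t
    have h₃ : IsCompactOperator
        (compress M (a : H →L[ℂ] H) ∘L (t - compress M (b : H →L[ℂ] H))) :=
      ht.clm_comp (compress M (a : H →L[ℂ] H))
    change IsCompactOperator (s * t - compress M ((a : H →L[ℂ] H) * b) : M →L[ℂ] M)
    have h₄ : s * t - compress M ((a : H →L[ℂ] H) * b) =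
        (s - compress M (a : H →L[ℂ] H)) * t +
          compress M (a : H →L[ℂ] H) * (t - compress M (b : H →L[ℂ] H)) -
        (compress M ((a : H →L[ℂ] H) * b) -
          compress M (a : H →L[ℂ] H) * compress M (b : H →L[ℂ] H)) := by
      rw [sub_mul, mul_sub]; abel
    rw [h₄]
    exact (h₂.add h₃).sub h₁
  add_mem' := by
    rintro ⟨a, s⟩ ⟨b, t⟩ hs ht
    change IsCompactOperator (s + t - compress M ((a : H →L[ℂ] H) + b) : M →L[ℂ] M)
    rw [compress_add, add_sub_add_comm]
    exact hs.add ht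
  algebraMap_mem' := by
    intro c
    change IsCompactOperator (algebraMap ℂ (M →L[ℂ] M) c -
      compress M (algebraMap ℂ (H →L[ℂ] H) c) : M →L[ℂ] M)
    rw [Algebra.algebraMap_eq_smul_one, Algebra.algebraMap_eq_smul_one, compress_smul,
      compress_one, sub_self]
    exact isCompactOperator_zero
  star_mem' := by
    rintro ⟨a, s⟩ hs
    change IsCompactOperator (ContinuousLinearMap.adjoint s -
      compress M (ContinuousLinearMap.adjoint (a : H →L[ℂ] H)) : M →L[ℂ] M)
    rw [← compress_adjoint, ← map_sub]
    exact IsCompactOperator.adjoint hs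

theorem isClosed_toeplitzPairs
    (h : ∀ a ∈ 𝓐, IsCompactOperator (M.starProjection * a - a * M.starProjection : H →L[ℂ] H)) :
    IsClosed (toeplitzPairs h : Set (𝓐 × (M →L[ℂ] M))) := by
  have hcl : IsClosed {f : M →L[ℂ] M | IsCompactOperator f} :=
    isClosed_setOfPred_isCompactOperator (σ₁₂ := RingHom.id ℂ)
  exact hcl.preimage (continuous_snd.sub
    ((continuous_compress M).comp (continuous_subtype_val.comp continuous_fst)))

/-- If a closed star-subalgebra of `A × B` has an injective projection to `B`, this projection is
isometric, so that its range is closed and contains each C*-algebra generated by a part of it. -/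
theorem exists_starAlgHom_of_pairs {A B : Type*} [CStarAlgebra A] [CStarAlgebra B]
    (s : StarSubalgebra ℂ (A × B)) [IsClosed (s : Set (A × B))]
    (hinj : ∀ a, (a, (0 : B)) ∈ s → a = 0) (t : Set B) (ht : ∀ b ∈ t, ∃ a, (a, b) ∈ s) :
    ∃ ρ : (StarAlgebra.adjoin ℂ t).topologicalClosure →⋆ₐ[ℂ] A,
      ∀ x : (StarAlgebra.adjoin ℂ t).topologicalClosure, (ρ x, (x : B)) ∈ s := by
  let f : s →⋆ₐ[ℂ] B := (StarAlgHom.snd ℂ A B).comp s.subtype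
  have hf : Function.Injective f := by
    rw [injective_iff_map_eq_zero]
    rintro ⟨⟨a, b⟩, hab⟩ (rfl : b = 0)
    obtain rfl := hinj a hab
    rfl
  have hcl : IsClosed ((StarAlgHom.range f : StarSubalgebra ℂ B) : Set B) :=
    (NonUnitalStarAlgHom.isometry f hf).isClosedEmbedding.isClosed_range
  have hle : (StarAlgebra.adjoin ℂ t).topologicalClosure ≤ StarAlgHom.range f := by
    refine StarSubalgebra.topologicalClosure_minimal (StarAlgebra.adjoin_le fun b hb => ?_) hcl
    obtain ⟨a, ha⟩ := ht b hb
    exact ⟨⟨_, ha⟩, rfl⟩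
  let e : s ≃⋆ₐ[ℂ] (StarAlgHom.range f : StarSubalgebra ℂ B) := StarAlgEquiv.ofInjective f hf
  refine ⟨(StarAlgHom.fst ℂ A B).comp (s.subtype.comp
    ((e.symm : (StarAlgHom.range f : StarSubalgebra ℂ B) →⋆ₐ[ℂ] s).comp
      (StarSubalgebra.inclusion hle))), fun x => ?_⟩
  have h₂ : (((e.symm (StarSubalgebra.inclusion hle x) : s) : A × B)).2 = x :=
    congrArg Subtype.val (e.apply_symm_apply (StarSubalgebra.inclusion hle x))
  have h₁ : ((e.symm (StarSubalgebra.inclusion hle x) : s) : A × B) ∈ s :=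
    (e.symm (StarSubalgebra.inclusion hle x)).2
  rw [← h₂]
  exact h₁

/-- If `φ` is faithful, the Toeplitz extension has a homomorphism `ρ` to `𝓐` with `t - T(ρ(t))`
compact. -/
theorem exists_symbol_hom [IsClosed (𝓐 : Set (H →L[ℂ] H))]
    (h : ∀ a ∈ 𝓐, IsCompactOperator (M.starProjection * a - a * M.starProjection : H →L[ℂ] H))
    (hφ : Function.Injective (phi 𝓐 M)) :
    ∃ ρ : toeplitzExtension 𝓐 M →⋆ₐ[ℂ] 𝓐, ∀ t : toeplitzExtension 𝓐 M,
      IsCompactOperator ((t : M →L[ℂ] M) - compress M (ρ t : H →L[ℂ] H) : M →L[ℂ] M) := by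
  have : IsClosed (toeplitzPairs h : Set (𝓐 × (M →L[ℂ] M))) := isClosed_toeplitzPairs h
  have hmain := exists_starAlgHom_of_pairs (A := 𝓐) (B := M →L[ℂ] M) (toeplitzPairs h)
  have hρ := hmain (by
    intro a ha
    change IsCompactOperator (0 - compress M (a : H →L[ℂ] H) : M →L[ℂ] M) at ha
    refine hφ ((Ideal.Quotient.eq).2 ?_)
    change IsCompactOperator (compress M (a : H →L[ℂ] H) - compress M 0 : M →L[ℂ] M)
    rw [compress_zero, sub_zero]
    rw [zero_sub] at ha
    simpa using ha.neg)
    (compress M '' (𝓐 : Set (H →L[ℂ] H)) ∪ {k | IsCompactOperator k}) (by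
    rintro t (⟨a, ha, rfl⟩ | ht)
    · refine ⟨⟨a, ha⟩, ?_⟩
      change IsCompactOperator (compress M a - compress M a : M →L[ℂ] M)
      rw [sub_self]
      exact isCompactOperator_zero
    · refine ⟨0, ?_⟩
      change IsCompactOperator (t - compress M 0 : M →L[ℂ] M)
      rwa [compress_zero, sub_zero])
  exact hρ

end Extension

/-! ### Bounded operators mapping into the domain of a self-adjoint operator -/

section MapsBounded

variable {E F G : Type*}
  [NormedAddCommGroup E] [InnerProductSpace ℂ E]
  [NormedAddCommGroup F] [InnerProductSpace ℂ F]
  [NormedAddCommGroup G] [InnerProductSpace ℂ G]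

/-- The product `S k` of an unbounded operator `S` and a bounded operator `k` is everywhere defined
and bounded. -/
def MapsBounded (S : F →ₗ.[ℂ] F) (k : E →L[ℂ] F) : Prop :=
  ∃ C : ℝ, 0 ≤ C ∧ ∀ x, ∃ y, (k x, y) ∈ S.graph ∧ ‖y‖ ≤ C * ‖x‖

section Basic

variable {S : F →ₗ.[ℂ] F} {k l : E →L[ℂ] F}

theorem MapsBounded.zero : MapsBounded S (0 : E →L[ℂ] F) :=
  ⟨0, le_rfl, fun _ => ⟨0, S.graph.zero_mem, by simp⟩⟩

theorem MapsBounded.add (hk : MapsBounded S k) (hl : MapsBounded S l) : MapsBounded S (k + l) := by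
  obtain ⟨C, hC, hk⟩ := hk
  obtain ⟨C', hC', hl⟩ := hl
  refine ⟨C + C', add_nonneg hC hC', fun x => ?_⟩
  obtain ⟨y, hy, h⟩ := hk x
  obtain ⟨y', hy', h'⟩ := hl x
  refine ⟨y + y', S.graph.add_mem hy hy', ?_⟩
  rw [add_mul]
  exact (norm_add_le _ _).trans (add_le_add h h')

theorem MapsBounded.smul (hk : MapsBounded S k) (c : ℂ) : MapsBounded S (c • k) := by
  obtain ⟨C, hC, hk⟩ := hk
  refine ⟨‖c‖ * C, by positivity, fun x => ?_⟩
  obtain ⟨y, hy, h⟩ := hk x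
  refine ⟨c • y, S.graph.smul_mem c hy, ?_⟩
  rw [norm_smul, mul_assoc]
  gcongr

theorem MapsBounded.comp (hk : MapsBounded S k) (b : G →L[ℂ] E) : MapsBounded S (k ∘L b) := by
  obtain ⟨C, hC, hk⟩ := hk
  refine ⟨C * ‖b‖, by positivity, fun x => ?_⟩
  obtain ⟨y, hy, h⟩ := hk (b x)
  refine ⟨y, hy, h.trans ?_⟩
  rw [mul_assoc]
  gcongr
  exact b.le_opNorm x

theorem mapsBounded_starProjection_comp (U : Submodule ℂ F) [FiniteDimensional ℂ U]
    (hU : U ≤ S.domain) (b : E →L[ℂ] F) : MapsBounded S (U.starProjection ∘L b) := by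
  refine MapsBounded.comp ?_ b
  let f : U →L[ℂ] F := LinearMap.toContinuousLinearMap (S.toFun ∘ₗ Submodule.inclusion hU)
  refine ⟨‖f‖, f.opNorm_nonneg, fun x => ⟨f (U.orthogonalProjectionOnto x), ?_, ?_⟩⟩
  · exact mem_graph_iff_exists.2 ⟨hU (U.orthogonalProjectionOnto x).2, rfl⟩
  · refine (f.le_opNorm _).trans ?_
    gcongr
    exact U.norm_orthogonalProjectionOnto_apply_le x

end Basic

variable [CompleteSpace E] [CompleteSpace F] [CompleteSpace G]

section

variable {S : F →ₗ.[ℂ] F} {k : E →L[ℂ] F}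

/-- If `u ↦ ⟪S u, w⟫` has norm at most `C` on `dom S`, then `S w` is defined and `‖S w‖ ≤ C`. -/
theorem exists_graph_of_bound (hS : IsSelfAdjoint S) {w : F} {C : ℝ} (hC : 0 ≤ C)
    (h : ∀ u v, (u, v) ∈ S.graph → ‖⟪v, w⟫_ℂ‖ ≤ C * ‖u‖) : ∃ y, (w, y) ∈ S.graph ∧ ‖y‖ ≤ C := by
  obtain ⟨y, hy⟩ := mem_domain_iff_exists_graph.1 (hS.mem_domain_of_bound h)
  refine ⟨y, hy, ?_⟩
  have hdense : ∀ u : F, ‖⟪u, y⟫_ℂ‖ ≤ C * ‖u‖ := by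
    intro u
    refine hS.dense_domain.induction (P := fun u => ‖⟪u, y⟫_ℂ‖ ≤ C * ‖u‖) ?_ ?_ u
    · intro u hu
      obtain ⟨v, huv⟩ := mem_domain_iff_exists_graph.1 hu
      rw [← hS.inner_graph hy huv]
      exact h u v huv
    · exact isClosed_le (by fun_prop) (by fun_prop)
  have := hdense y
  rw [norm_inner_symm, inner_self_eq_norm_sq_to_K] at this
  rcases (norm_nonneg y).eq_or_lt with h0 | h0
  · rwa [← h0]
  · refine le_of_mul_le_mul_right ?_ h0
    simpa [sq] using this

omit [CompleteSpace E] in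
/-- It suffices to have the defining property of `MapsBounded` on a dense set. -/
theorem mapsBounded_of_dense (hS : IsSelfAdjoint S) {s : Set E} (hs : Dense s) {C : ℝ} (hC : 0 ≤ C)
    (h : ∀ x ∈ s, ∃ y, (k x, y) ∈ S.graph ∧ ‖y‖ ≤ C * ‖x‖) : MapsBounded S k := by
  refine ⟨C, hC, fun x => exists_graph_of_bound hS (by positivity) fun u v huv => ?_⟩
  refine hs.induction (P := fun x => ‖⟪v, k x⟫_ℂ‖ ≤ C * ‖x‖ * ‖u‖) ?_ ?_ x
  · intro x hx
    obtain ⟨y, hy, hyC⟩ := h x hx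
    rw [hS.inner_graph hy huv]
    refine (norm_inner_le_norm _ _).trans ?_
    rw [mul_comm]
    gcongr
  · exact isClosed_le (by fun_prop) (by fun_prop)

omit [CompleteSpace E] in
theorem isDenselyDefinedBounded_mulBounded_iff (hS : IsSelfAdjoint S) :
    IsDenselyDefinedBounded (mulBounded S k) ↔ MapsBounded S k := by
  rw [isDenselyDefinedBounded_iff]
  constructor
  · rintro ⟨hd, C, hC, h⟩
    refine mapsBounded_of_dense hS hd hC fun x hx => ?_
    obtain ⟨y, hy⟩ := mem_domain_iff_exists_graph.1 hx
    exact ⟨y, mem_graph_mulBounded.1 hy, h _ _ hy⟩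
  · rintro ⟨C, hC, h⟩
    have htop : (mulBounded S k).domain = ⊤ := by
      rw [eq_top_iff]
      intro x _
      obtain ⟨y, hy, -⟩ := h x
      exact mem_domain_iff_exists_graph.2 ⟨y, mem_graph_mulBounded.2 hy⟩
    refine ⟨by rw [htop]; exact dense_univ, C, hC, fun x y hxy => ?_⟩
    obtain ⟨z, hz, hzC⟩ := h x
    obtain rfl := LinearPMap.mem_graph_snd_inj _ (mem_graph_mulBounded.1 hxy) hz rfl
    exact hzC

end

/-- `b S` is bounded exactly if `S b†` is everywhere defined and bounded. -/
theorem isDenselyDefinedBounded_boundedMul_iff {S : E →ₗ.[ℂ] E} {b : E →L[ℂ] F}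
    (hS : IsSelfAdjoint S) :
    IsDenselyDefinedBounded (boundedMul b S) ↔
      MapsBounded S (ContinuousLinearMap.adjoint b) := by
  rw [isDenselyDefinedBounded_iff]
  constructor
  · rintro ⟨-, C, hC, h⟩
    refine ⟨C, hC, fun y => exists_graph_of_bound hS (by positivity) fun u v huv => ?_⟩
    rw [ContinuousLinearMap.adjoint_inner_right]
    refine (norm_inner_le_norm _ _).trans ?_
    have := h u (b v) (mem_graph_boundedMul.2 ⟨v, huv, rfl⟩)
    calc ‖b v‖ * ‖y‖ ≤ C * ‖u‖ * ‖y‖ := by gcongr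
      _ = C * ‖y‖ * ‖u‖ := by ring
  · rintro ⟨C, hC, h⟩
    refine ⟨hS.dense_domain, C, hC, fun x y hxy => ?_⟩
    obtain ⟨v, hv, rfl⟩ := mem_graph_boundedMul.1 hxy
    obtain ⟨w, hw, hwC⟩ := h (b v)
    have h₁ : ⟪b v, b v⟫_ℂ = ⟪x, w⟫_ℂ := by
      rw [← hS.inner_graph hw hv, ContinuousLinearMap.adjoint_inner_right]
    have h₂ : ‖b v‖ * ‖b v‖ ≤ C * ‖x‖ * ‖b v‖ := by
      calc ‖b v‖ * ‖b v‖ = ‖⟪b v, b v⟫_ℂ‖ := by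
            rw [inner_self_eq_norm_sq_to_K]; simp [sq]
        _ ≤ ‖x‖ * ‖w‖ := by rw [h₁]; exact norm_inner_le_norm _ _
        _ ≤ ‖x‖ * (C * ‖b v‖) := by gcongr
        _ = _ := by ring
    rcases (norm_nonneg (b v)).eq_or_lt with h0 | h0
    · rw [← h0]; positivity
    · exact le_of_mul_le_mul_right h₂ h0

end MapsBounded

/-! ### Restrictions to reducing subspaces -/

section Restrict

variable {H : Type*} [NormedAddCommGroup H] [InnerProductSpace ℂ H] [CompleteSpace H]
  {D : H →ₗ.[ℂ] H} {M : Submodule ℂ H} [CompleteSpace M]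

omit [CompleteSpace H] in
theorem ProjCommutes.map_graph (h : ProjCommutes D M) {x y : H} (hxy : (x, y) ∈ D.graph) :
    (M.starProjection x, M.starProjection y) ∈ D.graph := by
  obtain ⟨hx, rfl⟩ := mem_graph_iff_exists.1 hxy
  obtain ⟨h₁, h₂⟩ := h ⟨x, hx⟩
  exact mem_graph_iff_exists.2 ⟨h₁, h₂⟩

theorem ProjCommutes.orthogonal (h : ProjCommutes D M) : ProjCommutes D Mᗮ := by
  intro x
  have h₁ : ((x : H) - M.starProjection x, D x - M.starProjection (D x)) ∈ D.graph :=
    D.graph.sub_mem (D.mem_graph x) (h.map_graph (D.mem_graph x))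
  rw [← M.starProjection_orthogonal_val, ← M.starProjection_orthogonal_val] at h₁
  exact mem_graph_iff_exists.1 h₁

omit [CompleteSpace H] in
theorem ProjCommutes.mem_graph_restrict (h : ProjCommutes D M) {x y : M} :
    (x, y) ∈ (restrict D M).graph ↔ ((x : H), (y : H)) ∈ D.graph := by
  rw [restrict, mem_graph_boundedMul]
  simp only [mem_graph_mulBounded]
  constructor
  · rintro ⟨z, hz, rfl⟩
    have := h.map_graph hz
    rwa [Submodule.subtypeL_apply, M.starProjection_mem_subspace_eq_self] at this
  · intro hxy
    exact ⟨y, hxy, (M.orthogonalProjectionOnto_mem_subspace_eq_self y).symm⟩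

omit [CompleteSpace H] in
theorem ProjCommutes.onto_graph (h : ProjCommutes D M) {x y : H} (hxy : (x, y) ∈ D.graph) :
    (M.orthogonalProjectionOnto x, M.orthogonalProjectionOnto y) ∈ (restrict D M).graph :=
  h.mem_graph_restrict.2 (h.map_graph hxy)

theorem ProjCommutes.isSelfAdjoint_restrict (h : ProjCommutes D M) (hD : IsSelfAdjoint D) :
    IsSelfAdjoint (restrict D M) := by
  rw [isSelfAdjoint_iff_graph]
  constructor
  · have hsurj : Function.Surjective M.orthogonalProjectionOnto := fun x =>
      ⟨x, M.orthogonalProjectionOnto_mem_subspace_eq_self x⟩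
    refine (hsurj.denseRange.dense_image M.orthogonalProjectionOnto.continuous
      hD.dense_domain).mono ?_
    rintro _ ⟨x, hx, rfl⟩
    obtain ⟨y, hy⟩ := mem_domain_iff_exists_graph.1 hx
    exact mem_domain_iff_exists_graph.2 ⟨_, h.onto_graph hy⟩
  · intro x y
    rw [h.mem_graph_restrict, hD.mem_graph_iff]
    constructor
    · intro h' u v huv
      exact h' u v (h.mem_graph_restrict.1 huv)
    · intro h' u v huv
      have := h' _ _ (h.onto_graph huv)
      simpa using this

end Restrict

/-! ### The smooth subalgebra of the Toeplitz extension -/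

section Generated

variable {E : Type*} [NormedAddCommGroup E] [InnerProductSpace ℂ E] [CompleteSpace E]

theorem subset_generatedCStarAlgebra (s : Set (E →L[ℂ] E)) :
    s ⊆ (generatedCStarAlgebra E s : Set (E →L[ℂ] E)) :=
  (StarAlgebra.subset_adjoin ℂ s).trans (StarSubalgebra.le_topologicalClosure _)

theorem mem_closure_of_norm_sub_lt {S : StarSubalgebra ℂ (E →L[ℂ] E)} {s : Set S} {t : S}
    (h : ∀ ε : ℝ, 0 < ε → ∃ x ∈ s, ‖(t : E →L[ℂ] E) - x‖ < ε) : t ∈ closure s := by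
  rw [Metric.mem_closure_iff]
  intro ε hε
  obtain ⟨x, hx, h⟩ := h ε hε
  exact ⟨x, hx, by rwa [Subtype.dist_eq, dist_eq_norm]⟩

end Generated

section Smooth

variable {H : Type*} [NormedAddCommGroup H] [InnerProductSpace ℂ H]
  {D : H →ₗ.[ℂ] H} {M : Submodule ℂ H} [CompleteSpace M]

/-- The off-diagonal corner `P a |(I - P)H` of `a`. -/
def corner (M : Submodule ℂ H) [CompleteSpace M] (a : H →L[ℂ] H) : Mᗮ →L[ℂ] M :=
  M.orthogonalProjectionOnto ∘L a ∘L Mᗮ.subtypeL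

/-- `T(ab) - T(a) T(b) = P a (I - P) b P`. -/
theorem compress_mul_sub_eq_corner (a b : H →L[ℂ] H) :
    compress M (a * b) - compress M a * compress M b =
      corner M a ∘L (Mᗮ.orthogonalProjectionOnto ∘L b ∘L M.subtypeL) := by
  ext x
  change M.starProjection (a (b x)) - M.starProjection (a (M.starProjection (b x))) =
    M.starProjection (a (Mᗮ.starProjection (b x)))
  rw [M.starProjection_orthogonal_val, map_sub, map_sub]

theorem mem_smoothCompacts_iff (hT : IsSelfAdjoint (restrict D M)) {k : M →L[ℂ] M} :
    k ∈ smoothCompacts D M ↔ IsCompactOperator k ∧ MapsBounded (restrict D M) k ∧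
      MapsBounded (restrict D M) (ContinuousLinearMap.adjoint k) := by
  rw [← isDenselyDefinedBounded_mulBounded_iff hT, ← isDenselyDefinedBounded_boundedMul_iff hT]
  rfl

theorem add_mem_smoothCompacts (hT : IsSelfAdjoint (restrict D M)) {k l : M →L[ℂ] M}
    (hk : k ∈ smoothCompacts D M) (hl : l ∈ smoothCompacts D M) :
    k + l ∈ smoothCompacts D M := by
  rw [mem_smoothCompacts_iff hT] at *
  exact ⟨hk.1.add hl.1, hk.2.1.add hl.2.1, by rw [map_add]; exact hk.2.2.add hl.2.2⟩

theorem smul_mem_smoothCompacts (hT : IsSelfAdjoint (restrict D M)) {k : M →L[ℂ] M} (c : ℂ)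
    (hk : k ∈ smoothCompacts D M) : c • k ∈ smoothCompacts D M := by
  rw [mem_smoothCompacts_iff hT] at *
  exact ⟨hk.1.smul c, hk.2.1.smul c, by rw [map_smulₛₗ]; exact hk.2.2.smul _⟩

theorem adjoint_mem_smoothCompacts (hT : IsSelfAdjoint (restrict D M)) {k : M →L[ℂ] M}
    (hk : k ∈ smoothCompacts D M) : ContinuousLinearMap.adjoint k ∈ smoothCompacts D M := by
  rw [mem_smoothCompacts_iff hT] at *
  exact ⟨IsCompactOperator.adjoint hk.1, hk.2.2,
    by rw [ContinuousLinearMap.adjoint_adjoint]; exact hk.2.1⟩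

theorem zero_mem_smoothCompacts (hT : IsSelfAdjoint (restrict D M)) :
    (0 : M →L[ℂ] M) ∈ smoothCompacts D M := by
  rw [mem_smoothCompacts_iff hT, map_zero]
  exact ⟨isCompactOperator_zero, .zero, .zero⟩

/-- The operators in `A_c` are dense in the compact operators. -/
theorem exists_mem_smoothCompacts_norm_sub_lt (hT : IsSelfAdjoint (restrict D M))
    {k : M →L[ℂ] M} (hk : IsCompactOperator k) {ε : ℝ} (hε : 0 < ε) :
    ∃ l ∈ smoothCompacts D M, ‖k - l‖ < ε := by
  obtain ⟨U, V, hU, hV, hUS, hVS, h⟩ :=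
    exists_norm_sub_starProjection_conj_lt hk (restrict D M).domain hT.dense_domain hε
  refine ⟨_, (mem_smoothCompacts_iff hT).2 ⟨?_, ?_, ?_⟩, h⟩
  · exact (hk.comp_clm V.starProjection).clm_comp U.starProjection
  · exact mapsBounded_starProjection_comp U hUS _
  · have hU' : ContinuousLinearMap.adjoint U.starProjection = U.starProjection :=
      isSelfAdjoint_starProjection U
    have hV' : ContinuousLinearMap.adjoint V.starProjection = V.starProjection :=
      isSelfAdjoint_starProjection V
    rw [ContinuousLinearMap.adjoint_comp, ContinuousLinearMap.adjoint_comp, hU', hV',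
      ContinuousLinearMap.comp_assoc]
    exact mapsBounded_starProjection_comp V hVS _

theorem mul_mem_smoothCompacts (hT : IsSelfAdjoint (restrict D M)) {k l : M →L[ℂ] M}
    (hk : k ∈ smoothCompacts D M) (hl : l ∈ smoothCompacts D M) :
    k * l ∈ smoothCompacts D M := by
  rw [mem_smoothCompacts_iff hT] at *
  refine ⟨hk.1.comp_clm l, hk.2.1.comp l, ?_⟩
  have : ContinuousLinearMap.adjoint (k * l) =
    ContinuousLinearMap.adjoint l ∘L ContinuousLinearMap.adjoint k :=
    ContinuousLinearMap.adjoint_comp _ _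
  rw [this]
  exact hl.2.2.comp _

variable [CompleteSpace H] {𝓐 : StarSubalgebra ℂ (H →L[ℂ] H)}

theorem adjoint_corner (a : H →L[ℂ] H) :
    ContinuousLinearMap.adjoint (corner M a) =
      Mᗮ.orthogonalProjectionOnto ∘L ContinuousLinearMap.adjoint a ∘L M.subtypeL := by
  rw [corner, ContinuousLinearMap.adjoint_comp, ContinuousLinearMap.adjoint_comp,
    Submodule.adjoint_orthogonalProjectionOnto, Submodule.adjoint_subtypeL]
  rfl

variable [IsClosed (𝓐 : Set (H →L[ℂ] H))] {A : Set 𝓐}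

section Quadruple

variable (hQ : IsToeplitzQuadruple 𝓐 A D M)
include hQ

theorem IsToeplitzQuadruple.isSelfAdjoint : IsSelfAdjoint D := hQ.isSpectralTriple.isSelfAdjoint

theorem IsToeplitzQuadruple.projCommutes : ProjCommutes D M := hQ.isToeplitzProjection.commutes

theorem IsToeplitzQuadruple.isSelfAdjoint_restrict : IsSelfAdjoint (restrict D M) :=
  hQ.projCommutes.isSelfAdjoint_restrict hQ.isSelfAdjoint

theorem IsToeplitzQuadruple.star_mem {a : 𝓐} (ha : a ∈ A) : star a ∈ A := by
  obtain ⟨S, rfl⟩ := hQ.isSpectralTriple.isSubalgebra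
  exact S.star_mem' ha

/-- The commutators `[PD, a]`, `a ∈ A`, are bounded. -/
theorem IsToeplitzQuadruple.exists_bound_commutator_p {a : 𝓐} (ha : a ∈ A) :
    ∃ C : ℝ, 0 ≤ C ∧ ∀ x u v, (x, u) ∈ D.graph → ((a : H →L[ℂ] H) x, v) ∈ D.graph →
      ‖M.starProjection v - (a : H →L[ℂ] H) (M.starProjection u)‖ ≤ C * ‖x‖ := by
  obtain ⟨-, C, hC, h⟩ := isDenselyDefinedBounded_iff.1 (hQ.commutator_p a ha)
  refine ⟨C, hC, fun x u v hu hv => h x _ ?_⟩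
  exact mem_graph_opCommutator.2 ⟨_, _, mem_graph_boundedMul.2 ⟨v, hv, rfl⟩,
    mem_graph_boundedMul.2 ⟨u, hu, rfl⟩, rfl⟩

/-- `D_p P a (I - P)` is bounded: for `x ∈ (I - P)H` in the domain of `[D, a]` the vector
`D_p P a x` is `[PD, a] x`. -/
theorem IsToeplitzQuadruple.mapsBounded_corner {a : 𝓐} (ha : a ∈ A) :
    MapsBounded (restrict D M) (corner M (a : H →L[ℂ] H)) := by
  obtain ⟨C, hC, h⟩ := hQ.exists_bound_commutator_p ha
  refine mapsBounded_of_dense hQ.isSelfAdjoint_restrict (hQ.dense_q a ha) hC fun x hx => ?_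
  obtain ⟨_, hy⟩ := mem_domain_iff_exists_graph.1
    (show (x : H) ∈ (opCommutator D (a : H →L[ℂ] H)).domain from hx)
  obtain ⟨v, u, hv, hu, -⟩ := mem_graph_opCommutator.1 hy
  refine ⟨_, hQ.projCommutes.onto_graph hv, ?_⟩
  have hu' : M.starProjection u = 0 := by
    have h₁ := hQ.projCommutes.map_graph hu
    have h₂ : M.starProjection (x : H) = 0 :=
      M.starProjection_apply_eq_zero_iff.2 x.2
    rw [h₂] at h₁
    exact LinearPMap.graph_fst_eq_zero_snd _ h₁ rfl
  have h₃ := h x u v hu hv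
  rw [hu', map_zero, sub_zero] at h₃
  exact h₃

/-- `(I - P) a D_p` is bounded: its adjoint contains `D_p P a* (I - P)`. -/
theorem IsToeplitzQuadruple.isDenselyDefinedBounded_corner_mul_restrict {a : 𝓐} (ha : a ∈ A) :
    IsDenselyDefinedBounded (boundedMul
      (Mᗮ.orthogonalProjectionOnto ∘L (a : H →L[ℂ] H) ∘L M.subtypeL) (restrict D M)) := by
  have h₁ := hQ.mapsBounded_corner (hQ.star_mem ha)
  have h₂ : Mᗮ.orthogonalProjectionOnto ∘L (a : H →L[ℂ] H) ∘L M.subtypeL =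
      ContinuousLinearMap.adjoint (corner M ((star a : 𝓐) : H →L[ℂ] H)) := by
    rw [adjoint_corner]
    congr 2
    exact (ContinuousLinearMap.adjoint_adjoint (a : H →L[ℂ] H)).symm
  rw [isDenselyDefinedBounded_boundedMul_iff hQ.isSelfAdjoint_restrict, h₂,
    ContinuousLinearMap.adjoint_adjoint]
  exact h₁

/-- `T(a) T(b) - T(ab)` lies in `A_c`. -/
theorem IsToeplitzQuadruple.compress_mul_sub_mem {a b : 𝓐} (ha : a ∈ A) (hb : b ∈ A) :
    compress M (a : H →L[ℂ] H) * compress M (b : H →L[ℂ] H) - compress M ((a * b : 𝓐) : H →L[ℂ] H)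
      ∈ smoothCompacts D M := by
  have hT := hQ.isSelfAdjoint_restrict
  rw [← neg_sub, ← neg_one_smul ℂ]
  refine smul_mem_smoothCompacts hT _ ((mem_smoothCompacts_iff hT).2 ⟨?_, ?_, ?_⟩)
  · exact isCompactOperator_compress_mul_sub
      (hQ.isToeplitzProjection.commutes_mod_compact a a.2) (b : H →L[ℂ] H)
  · change MapsBounded _ (compress M ((a : H →L[ℂ] H) * b) - _)
    rw [compress_mul_sub_eq_corner]
    exact (hQ.mapsBounded_corner ha).comp _
  · have h₁ : ContinuousLinearMap.adjoint (compress M ((a : H →L[ℂ] H) * b) -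
        compress M (a : H →L[ℂ] H) * compress M (b : H →L[ℂ] H)) =
        compress M (((star b : 𝓐) : H →L[ℂ] H) * ((star a : 𝓐) : H →L[ℂ] H)) -
        compress M ((star b : 𝓐) : H →L[ℂ] H) * compress M ((star a : 𝓐) : H →L[ℂ] H) := by
      rw [map_sub, compress_adjoint]
      congr 1
      · exact congrArg (compress M) (star_mul (a : H →L[ℂ] H) b)
      · change star (_ * _) = _
        rw [star_mul]
        congr 1
        · exact compress_adjoint M (b : H →L[ℂ] H)
        · exact compress_adjoint M (a : H →L[ℂ] H)
    change MapsBounded _ (ContinuousLinearMap.adjoint (compress M ((a : H →L[ℂ] H) * b) - _))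
    rw [h₁, compress_mul_sub_eq_corner]
    exact (hQ.mapsBounded_corner (hQ.star_mem hb)).comp _

variable (hdom : ∀ a ∈ A, ∀ x ∈ (restrict D M).domain,
      compress M (a : H →L[ℂ] H) x ∈ (restrict D M).domain)
include hdom

/-- The commutator `[D_p, T(a)]` is bounded on `dom D_p`: the hypotheses bound `[D_p, T(a*)]` on a
dense set, and `-[D_p, T(a)]` is contained in the adjoint of this restriction. -/
theorem IsToeplitzQuadruple.exists_bound_commutator_compress {a : 𝓐} (ha : a ∈ A) :
    ∃ C : ℝ, 0 ≤ C ∧ ∀ x y, (x, y) ∈ (restrict D M).graph →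
      ∃ z, (compress M (a : H →L[ℂ] H) x, z) ∈ (restrict D M).graph ∧
        ‖z - compress M (a : H →L[ℂ] H) y‖ ≤ C * ‖x‖ := by
  have hT := hQ.isSelfAdjoint_restrict
  have hs := hQ.star_mem ha
  obtain ⟨C, hC, h⟩ := hQ.exists_bound_commutator_p hs
  refine ⟨C, hC, fun x y hxy => ?_⟩
  obtain ⟨z, hz⟩ := mem_domain_iff_exists_graph.1
    (hdom a ha x (mem_domain_iff_exists_graph.2 ⟨y, hxy⟩))
  refine ⟨z, hz, ?_⟩
  set w := z - compress M (a : H →L[ℂ] H) y with hw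
  have hadj : ∀ p q : M, ⟪compress M ((star a : 𝓐) : H →L[ℂ] H) p, q⟫_ℂ =
      ⟪p, compress M (a : H →L[ℂ] H) q⟫_ℂ := by
    intro p q
    have : compress M ((star a : 𝓐) : H →L[ℂ] H) =
      ContinuousLinearMap.adjoint (compress M (a : H →L[ℂ] H)) := (compress_adjoint M _).symm
    rw [this, ContinuousLinearMap.adjoint_inner_left]
  have hbound : ∀ u : M, ‖⟪u, w⟫_ℂ‖ ≤ C * ‖x‖ * ‖u‖ := by
    intro u
    refine (hQ.dense_p _ hs).induction (P := fun u => ‖⟪u, w⟫_ℂ‖ ≤ C * ‖x‖ * ‖u‖) ?_ ?_ u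
    · intro u hu
      obtain ⟨_, hy⟩ := mem_domain_iff_exists_graph.1
        (show (u : H) ∈ (opCommutator D ((star a : 𝓐) : H →L[ℂ] H)).domain from hu)
      obtain ⟨r, v, hr, hv, -⟩ := mem_graph_opCommutator.1 hy
      have hv₁ := hQ.projCommutes.onto_graph hv
      rw [M.orthogonalProjectionOnto_mem_subspace_eq_self] at hv₁
      have hr₁ : (compress M ((star a : 𝓐) : H →L[ℂ] H) u, M.orthogonalProjectionOnto r) ∈
        (restrict D M).graph := hQ.projCommutes.onto_graph hr
      set v' := M.orthogonalProjectionOnto v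
      set r' := M.orthogonalProjectionOnto r
      have e : ⟪u, w⟫_ℂ = -⟪r' - compress M ((star a : 𝓐) : H →L[ℂ] H) v', x⟫_ℂ := by
        rw [hw, inner_sub_right, inner_sub_left, hadj, hT.inner_graph hz hv₁ |>.symm,
          hT.inner_graph hxy hr₁, hadj]
        ring
      have hb : ‖r' - compress M ((star a : 𝓐) : H →L[ℂ] H) v'‖ ≤ C * ‖u‖ := by
        refine le_trans ?_ (h u v r hv hr)
        have e₂ : r' - compress M ((star a : 𝓐) : H →L[ℂ] H) v' = M.orthogonalProjectionOnto
            (M.starProjection r - ((star a : 𝓐) : H →L[ℂ] H) (M.starProjection v)) := by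
          rw [map_sub]
          congr 1
          exact (M.orthogonalProjectionOnto_mem_subspace_eq_self r').symm
        rw [e₂]
        exact M.norm_orthogonalProjectionOnto_apply_le _
      rw [e, norm_neg]
      calc _ ≤ ‖r' - compress M ((star a : 𝓐) : H →L[ℂ] H) v'‖ * ‖x‖ := norm_inner_le_norm _ _
        _ ≤ C * ‖u‖ * ‖x‖ := by gcongr
        _ = _ := by ring
    · exact isClosed_le (by fun_prop) (by fun_prop)
  have h₁ := hbound w
  rw [inner_self_eq_norm_sq_to_K] at h₁
  rcases (norm_nonneg w).eq_or_lt with h0 | h0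
  · rw [← h0]; positivity
  · exact le_of_mul_le_mul_right (by simpa [sq] using h₁) h0

/-- `D_p T(a) k = T(a) D_p k + [D_p, T(a)] k` is bounded if `D_p k` is. -/
theorem IsToeplitzQuadruple.mapsBounded_compress_comp {a : 𝓐} (ha : a ∈ A) {k : M →L[ℂ] M}
    (hk : MapsBounded (restrict D M) k) :
    MapsBounded (restrict D M) (compress M (a : H →L[ℂ] H) ∘L k) := by
  obtain ⟨C, hC, h⟩ := hQ.exists_bound_commutator_compress hdom ha
  obtain ⟨C', hC', hk⟩ := hk
  refine ⟨C * ‖k‖ + ‖compress M (a : H →L[ℂ] H)‖ * C', by positivity, fun x => ?_⟩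
  obtain ⟨y, hy, hyC⟩ := hk x
  obtain ⟨z, hz, hzC⟩ := h _ _ hy
  refine ⟨z, hz, ?_⟩
  calc ‖z‖ = ‖(z - compress M (a : H →L[ℂ] H) y) + compress M (a : H →L[ℂ] H) y‖ := by
        rw [sub_add_cancel]
    _ ≤ C * (‖k‖ * ‖x‖) + ‖compress M (a : H →L[ℂ] H)‖ * (C' * ‖x‖) := by
        refine (norm_add_le _ _).trans (add_le_add (hzC.trans ?_) ?_)
        · gcongr; exact k.le_opNorm x
        · refine ((compress M (a : H →L[ℂ] H)).le_opNorm y).trans ?_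
          gcongr
    _ = _ := by ring

theorem IsToeplitzQuadruple.compress_mul_mem {a : 𝓐} (ha : a ∈ A) {k : M →L[ℂ] M}
    (hk : k ∈ smoothCompacts D M) : compress M (a : H →L[ℂ] H) * k ∈ smoothCompacts D M := by
  have hT := hQ.isSelfAdjoint_restrict
  rw [mem_smoothCompacts_iff hT] at *
  refine ⟨hk.1.clm_comp (compress M (a : H →L[ℂ] H)),
    hQ.mapsBounded_compress_comp hdom ha hk.2.1, ?_⟩
  have : ContinuousLinearMap.adjoint (compress M (a : H →L[ℂ] H) * k) =
    ContinuousLinearMap.adjoint k ∘L ContinuousLinearMap.adjoint (compress M (a : H →L[ℂ] H)) :=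
    ContinuousLinearMap.adjoint_comp _ _
  rw [this]
  exact hk.2.2.comp _

theorem IsToeplitzQuadruple.mul_compress_mem {a : 𝓐} (ha : a ∈ A) {k : M →L[ℂ] M}
    (hk : k ∈ smoothCompacts D M) : k * compress M (a : H →L[ℂ] H) ∈ smoothCompacts D M := by
  have hT := hQ.isSelfAdjoint_restrict
  have h := adjoint_mem_smoothCompacts hT
    (hQ.compress_mul_mem hdom (hQ.star_mem ha) (adjoint_mem_smoothCompacts hT hk))
  have e : compress M ((star a : 𝓐) : H →L[ℂ] H) =
    ContinuousLinearMap.adjoint (compress M (a : H →L[ℂ] H)) := (compress_adjoint M _).symm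
  have h₁ : ∀ S T : M →L[ℂ] M, ContinuousLinearMap.adjoint
      (ContinuousLinearMap.adjoint S * ContinuousLinearMap.adjoint T) = T * S := by
    intro S T
    change ContinuousLinearMap.adjoint
      (ContinuousLinearMap.adjoint S ∘L ContinuousLinearMap.adjoint T) = _
    rw [ContinuousLinearMap.adjoint_comp, ContinuousLinearMap.adjoint_adjoint,
      ContinuousLinearMap.adjoint_adjoint]
    rfl
  rwa [e, h₁] at h

/-- `A_t` is a self-adjoint subalgebra of the Toeplitz extension. -/
theorem IsToeplitzQuadruple.isSubalgebra_smoothToeplitz :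
    ∃ S : NonUnitalStarSubalgebra ℂ (toeplitzExtension 𝓐 M),
      (S : Set (toeplitzExtension 𝓐 M)) = smoothToeplitz 𝓐 A D M := by
  have hT := hQ.isSelfAdjoint_restrict
  obtain ⟨S, hS⟩ := hQ.isSpectralTriple.isSubalgebra
  have hA : ∀ a, a ∈ A ↔ a ∈ S := fun a => by rw [← hS]; rfl
  refine ⟨{ carrier := smoothToeplitz 𝓐 A D M, add_mem' := ?_, zero_mem' := ?_, mul_mem' := ?_,
            smul_mem' := ?_, star_mem' := ?_ }, rfl⟩
  · rintro s t ⟨a, ha, k, hk, hs⟩ ⟨b, hb, l, hl, ht⟩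
    refine ⟨a + b, (hA _).2 (S.add_mem' ((hA a).1 ha) ((hA b).1 hb)), k + l,
      add_mem_smoothCompacts hT hk hl, ?_⟩
    change (s : M →L[ℂ] M) + t = compress M ((a : H →L[ℂ] H) + b) + (k + l)
    rw [hs, ht, compress_add]
    abel
  · refine ⟨0, (hA _).2 S.zero_mem', 0, zero_mem_smoothCompacts hT, ?_⟩
    change (0 : M →L[ℂ] M) = compress M 0 + 0
    rw [compress_zero, add_zero]
  · rintro s t ⟨a, ha, k, hk, hs⟩ ⟨b, hb, l, hl, ht⟩
    refine ⟨a * b, (hA _).2 (S.mul_mem' ((hA a).1 ha) ((hA b).1 hb)), _,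
      add_mem_smoothCompacts hT (hQ.compress_mul_sub_mem ha hb)
        (add_mem_smoothCompacts hT (hQ.compress_mul_mem hdom ha hl)
          (add_mem_smoothCompacts hT (hQ.mul_compress_mem hdom hb hk)
            (mul_mem_smoothCompacts hT hk hl))), ?_⟩
    change (s : M →L[ℂ] M) * t = _
    rw [hs, ht, add_mul, mul_add, mul_add]
    abel
  · rintro c s ⟨a, ha, k, hk, hs⟩
    refine ⟨c • a, (hA _).2 (S.smul_mem' c ((hA a).1 ha)), c • k,
      smul_mem_smoothCompacts hT c hk, ?_⟩
    change c • (s : M →L[ℂ] M) = compress M (c • (a : H →L[ℂ] H)) + c • k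
    rw [hs, compress_smul, smul_add]
  · rintro s ⟨a, ha, k, hk, hs⟩
    refine ⟨star a, hQ.star_mem ha, _, adjoint_mem_smoothCompacts hT hk, ?_⟩
    change ContinuousLinearMap.adjoint (s : M →L[ℂ] M) =
      compress M (ContinuousLinearMap.adjoint (a : H →L[ℂ] H)) + _
    rw [hs, map_add, compress_adjoint]

omit hdom in
/-- `A_t` is dense: `ρ(t)` is approximated by elements of `A`, and the compact operator
`t - T(ρ(t))` by elements of `A_c`. -/
theorem IsToeplitzQuadruple.dense_smoothToeplitz
    {ρ : toeplitzExtension 𝓐 M →⋆ₐ[ℂ] 𝓐} (hρ : ∀ t : toeplitzExtension 𝓐 M,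
      IsCompactOperator ((t : M →L[ℂ] M) - compress M (ρ t : H →L[ℂ] H) : M →L[ℂ] M)) :
    Dense (smoothToeplitz 𝓐 A D M) := by
  refine fun t => mem_closure_of_norm_sub_lt fun ε hε => ?_
  obtain ⟨a, ha, hat⟩ := Metric.mem_closure_iff.1 (hQ.isSpectralTriple.dense (ρ t)) (ε / 2)
    (half_pos hε)
  obtain ⟨k, hk, hkt⟩ := exists_mem_smoothCompacts_norm_sub_lt hQ.isSelfAdjoint_restrict (hρ t)
    (half_pos hε)
  have hsub : compress M '' (𝓐 : Set (H →L[ℂ] H)) ∪ {k | IsCompactOperator k} ⊆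
      (toeplitzExtension 𝓐 M : Set (M →L[ℂ] M)) := subset_generatedCStarAlgebra _
  have hmem : compress M (a : H →L[ℂ] H) + k ∈ toeplitzExtension 𝓐 M :=
    add_mem (hsub (Or.inl ⟨a, a.2, rfl⟩)) (hsub (Or.inr hk.1))
  refine ⟨⟨_, hmem⟩, ⟨a, ha, k, hk, rfl⟩, ?_⟩
  rw [Subtype.dist_eq, dist_eq_norm] at hat
  have hsplit : (t : M →L[ℂ] M) - (compress M (a : H →L[ℂ] H) + k) =
      compress M ((ρ t : H →L[ℂ] H) - a) +
        ((t : M →L[ℂ] M) - compress M (ρ t : H →L[ℂ] H) - k) := by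
    rw [compress_sub]
    abel
  rw [hsplit]
  have h₁ := norm_compress_le M ((ρ t : H →L[ℂ] H) - a)
  refine (norm_add_le _ _).trans_lt ?_
  linarith

end Quadruple

end Smooth

/-! ### Block operators on a direct sum of two Hilbert spaces -/

section ProdNorm

theorem prod_ext {E F : Type*} {v w : WithLp 2 (E × F)} (h₁ : v.fst = w.fst)
    (h₂ : v.snd = w.snd) : v = w :=
  WithLp.ofLp_injective 2 (Prod.ext h₁ h₂)

variable {E F : Type*} [SeminormedAddCommGroup E] [SeminormedAddCommGroup F]

theorem norm_fst_le (v : WithLp 2 (E × F)) : ‖v.fst‖ ≤ ‖v‖ := by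
  have h := WithLp.prod_norm_sq_eq_of_L2 v
  exact le_of_sq_le_sq (by nlinarith [sq_nonneg ‖v.snd‖]) (norm_nonneg _)

theorem norm_snd_le (v : WithLp 2 (E × F)) : ‖v.snd‖ ≤ ‖v‖ := by
  have h := WithLp.prod_norm_sq_eq_of_L2 v
  exact le_of_sq_le_sq (by nlinarith [sq_nonneg ‖v.fst‖]) (norm_nonneg _)

theorem norm_le_add_norm (v : WithLp 2 (E × F)) : ‖v‖ ≤ ‖v.fst‖ + ‖v.snd‖ := by
  have h := WithLp.prod_norm_sq_eq_of_L2 v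
  exact le_of_sq_le_sq (by nlinarith [norm_nonneg v.fst, norm_nonneg v.snd]) (by positivity)

end ProdNorm

section Block

variable {E F : Type*}
  [NormedAddCommGroup E] [InnerProductSpace ℂ E]
  [NormedAddCommGroup F] [InnerProductSpace ℂ F]

variable (E F) in
/-- The embedding of the first summand. -/
def inlL : E →L[ℂ] WithLp 2 (E × F) :=
  ((WithLp.prodContinuousLinearEquiv 2 ℂ E F).symm : (E × F) →L[ℂ] WithLp 2 (E × F)) ∘L
    ContinuousLinearMap.inl ℂ E F

variable (E F) in
/-- The embedding of the second summand. -/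
def inrL : F →L[ℂ] WithLp 2 (E × F) :=
  ((WithLp.prodContinuousLinearEquiv 2 ℂ E F).symm : (E × F) →L[ℂ] WithLp 2 (E × F)) ∘L
    ContinuousLinearMap.inr ℂ E F

theorem inlL_apply (x : E) : inlL E F x = WithLp.toLp 2 (x, 0) := rfl

theorem inrL_apply (y : F) : inrL E F y = WithLp.toLp 2 (0, y) := rfl

theorem inlL_add_inrL (v : WithLp 2 (E × F)) : inlL E F v.fst + inrL E F v.snd = v :=
  prod_ext (by simp [inlL_apply, inrL_apply]) (by simp [inlL_apply, inrL_apply])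

/-- The operator `S ⊕ T` on the direct sum. -/
def blockDiag (S : E →L[ℂ] E) (T : F →L[ℂ] F) : WithLp 2 (E × F) →L[ℂ] WithLp 2 (E × F) :=
  inlL E F ∘L S ∘L WithLp.fstL 2 ℂ E F + inrL E F ∘L T ∘L WithLp.sndL 2 ℂ E F

theorem blockDiag_apply (S : E →L[ℂ] E) (T : F →L[ℂ] F) (v : WithLp 2 (E × F)) :
    blockDiag S T v = WithLp.toLp 2 (S v.fst, T v.snd) :=
  inlL_add_inrL (WithLp.toLp 2 (S v.fst, T v.snd))

theorem blockDiag_mul (S S' : E →L[ℂ] E) (T T' : F →L[ℂ] F) :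
    blockDiag (S * S') (T * T') = blockDiag S T * blockDiag S' T' := by
  ext v : 1
  change _ = blockDiag S T (blockDiag S' T' v)
  simp only [blockDiag_apply]
  rfl

theorem blockDiag_add (S S' : E →L[ℂ] E) (T T' : F →L[ℂ] F) :
    blockDiag (S + S') (T + T') = blockDiag S T + blockDiag S' T' := by
  ext v : 1
  change _ = blockDiag S T v + blockDiag S' T' v
  simp only [blockDiag_apply]
  rfl

theorem blockDiag_zero : blockDiag (0 : E →L[ℂ] E) (0 : F →L[ℂ] F) = 0 := by
  ext v : 1
  rw [blockDiag_apply]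
  rfl

theorem blockDiag_smul_one (c : ℂ) :
    blockDiag (c • (1 : E →L[ℂ] E)) (c • (1 : F →L[ℂ] F)) = c • 1 := by
  ext v : 1
  rw [blockDiag_apply]
  rfl

variable [CompleteSpace E] [CompleteSpace F]

theorem adjoint_blockDiag (S : E →L[ℂ] E) (T : F →L[ℂ] F) :
    ContinuousLinearMap.adjoint (blockDiag S T) =
      blockDiag (ContinuousLinearMap.adjoint S) (ContinuousLinearMap.adjoint T) := by
  symm
  rw [ContinuousLinearMap.eq_adjoint_iff]
  intro v w
  simp only [blockDiag_apply, WithLp.prod_inner_apply]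
  exact congrArg₂ (· + ·) (ContinuousLinearMap.adjoint_inner_left _ _ _)
    (ContinuousLinearMap.adjoint_inner_left _ _ _)

/-- The direct sum of representations. -/
def blockDiagHom {𝓑 : Type*} [Semiring 𝓑] [Algebra ℂ 𝓑] [Star 𝓑] (π₁ : 𝓑 →⋆ₐ[ℂ] (E →L[ℂ] E))
    (π₂ : 𝓑 →⋆ₐ[ℂ] (F →L[ℂ] F)) :
    𝓑 →⋆ₐ[ℂ] (WithLp 2 (E × F) →L[ℂ] WithLp 2 (E × F)) :=
  have hc (c : ℂ) : blockDiag (π₁ (algebraMap ℂ 𝓑 c)) (π₂ (algebraMap ℂ 𝓑 c)) = c • 1 := by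
    rw [AlgHomClass.commutes, AlgHomClass.commutes, Algebra.algebraMap_eq_smul_one,
      Algebra.algebraMap_eq_smul_one, blockDiag_smul_one]
  { toFun := fun b => blockDiag (π₁ b) (π₂ b)
    map_one' := by simpa only [map_one, one_smul] using hc 1
    map_mul' := fun a b => by rw [map_mul, map_mul, blockDiag_mul]
    map_zero' := by
      rw [map_zero, map_zero, blockDiag_zero]
    map_add' := fun a b => by rw [map_add, map_add, blockDiag_add]
    commutes' := fun c => (hc c).trans (Algebra.algebraMap_eq_smul_one c).symm
    map_star' := fun b => by
      rw [map_star, map_star]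
      exact (adjoint_blockDiag _ _).symm }

/-- The direct sum `S ⊕ T` of two unbounded operators. -/
def blockDiagPMap (S : E →ₗ.[ℂ] E) (T : F →ₗ.[ℂ] F) : WithLp 2 (E × F) →ₗ.[ℂ] WithLp 2 (E × F) :=
  boundedMul (inlL E F) (mulBounded S (WithLp.fstL 2 ℂ E F)) +
    boundedMul (inrL E F) (mulBounded T (WithLp.sndL 2 ℂ E F))

section PMap

variable {S : E →ₗ.[ℂ] E} {T : F →ₗ.[ℂ] F}

omit [CompleteSpace E] [CompleteSpace F] in
theorem mem_graph_blockDiagPMap {v w : WithLp 2 (E × F)} :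
    (v, w) ∈ (blockDiagPMap S T).graph ↔
      (v.fst, w.fst) ∈ S.graph ∧ (v.snd, w.snd) ∈ T.graph := by
  simp only [blockDiagPMap, mem_graph_add, mem_graph_boundedMul, mem_graph_mulBounded]
  constructor
  · rintro ⟨_, _, ⟨p, hp, rfl⟩, ⟨q, hq, rfl⟩, rfl⟩
    refine ⟨?_, ?_⟩
    · simpa [inlL_apply, inrL_apply] using hp
    · simpa [inlL_apply, inrL_apply] using hq
  · rintro ⟨h₁, h₂⟩
    exact ⟨_, _, ⟨_, h₁, rfl⟩, ⟨_, h₂, rfl⟩, (inlL_add_inrL w).symm⟩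

omit [CompleteSpace E] [CompleteSpace F] in
theorem dense_prod {s : Set E} {t : Set F} (hs : Dense s) (ht : Dense t) :
    Dense {v : WithLp 2 (E × F) | v.fst ∈ s ∧ v.snd ∈ t} :=
  (hs.prod ht).preimage (WithLp.prodContinuousLinearEquiv 2 ℂ E F).toHomeomorph.isOpenMap

theorem isSelfAdjoint_blockDiagPMap (hS : IsSelfAdjoint S) (hT : IsSelfAdjoint T) :
    IsSelfAdjoint (blockDiagPMap S T) := by
  rw [isSelfAdjoint_iff_graph]
  constructor
  · refine (dense_prod hS.dense_domain hT.dense_domain).mono ?_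
    rintro v ⟨h₁, h₂⟩
    obtain ⟨p, hp⟩ := mem_domain_iff_exists_graph.1 h₁
    obtain ⟨q, hq⟩ := mem_domain_iff_exists_graph.1 h₂
    exact mem_domain_iff_exists_graph.2
      ⟨WithLp.toLp 2 (p, q), mem_graph_blockDiagPMap.2 ⟨hp, hq⟩⟩
  · intro v w
    rw [mem_graph_blockDiagPMap]
    constructor
    · rintro ⟨h₁, h₂⟩ x y hxy
      obtain ⟨h₃, h₄⟩ := mem_graph_blockDiagPMap.1 hxy
      simp only [WithLp.prod_inner_apply]
      exact congrArg₂ (· + ·) (hS.inner_graph h₁ h₃) (hT.inner_graph h₂ h₄)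
    · intro h
      rw [hS.mem_graph_iff, hT.mem_graph_iff]
      constructor
      · intro x y hxy
        have := h (WithLp.toLp 2 (x, 0)) (WithLp.toLp 2 (y, 0))
          (mem_graph_blockDiagPMap.2 ⟨hxy, T.graph.zero_mem⟩)
        simpa [WithLp.prod_inner_apply] using this
      · intro x y hxy
        have := h (WithLp.toLp 2 (0, x)) (WithLp.toLp 2 (0, y))
          (mem_graph_blockDiagPMap.2 ⟨S.graph.zero_mem, hxy⟩)
        simpa [WithLp.prod_inner_apply] using this

omit [CompleteSpace E] [CompleteSpace F] in
theorem isInvOneAddSq_blockDiag {R : E →L[ℂ] E} {Q : F →L[ℂ] F} (hR : IsInvOneAddSq S R)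
    (hQ : IsInvOneAddSq T Q) : IsInvOneAddSq (blockDiagPMap S T) (blockDiag R Q) := by
  rw [isInvOneAddSq_iff]
  simp only [mem_graph_blockDiagPMap, blockDiag_apply]
  constructor
  · intro v
    obtain ⟨z, h₁, h₂⟩ := hR.exists_graph v.fst
    obtain ⟨w, h₃, h₄⟩ := hQ.exists_graph v.snd
    exact ⟨WithLp.toLp 2 (z, w), ⟨h₁, h₃⟩, ⟨h₂, h₄⟩⟩
  · rintro x z w ⟨h₁, h₂⟩ ⟨h₃, h₄⟩
    exact prod_ext (hR.apply_eq h₁ h₃ rfl) (hQ.apply_eq h₂ h₄ rfl)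

end PMap

omit [CompleteSpace E] [CompleteSpace F] in
theorem isCompactOperator_blockDiag {R : E →L[ℂ] E} {Q : F →L[ℂ] F} (hR : IsCompactOperator R)
    (hQ : IsCompactOperator Q) : IsCompactOperator (blockDiag R Q) :=
  ((hR.comp_clm (WithLp.fstL 2 ℂ E F)).clm_comp (inlL E F)).add
    ((hQ.comp_clm (WithLp.sndL 2 ℂ E F)).clm_comp (inrL E F))

theorem blockDiag_nonneg {R : E →L[ℂ] E} {Q : F →L[ℂ] F} (hR : 0 ≤ R) (hQ : 0 ≤ Q) :
    0 ≤ blockDiag R Q := by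
  rw [ContinuousLinearMap.nonneg_iff_isPositive] at *
  rw [ContinuousLinearMap.isPositive_def'] at *
  refine ⟨?_, fun v => ?_⟩
  · rw [ContinuousLinearMap.isSelfAdjoint_iff'] at *
    rw [adjoint_blockDiag, hR.1, hQ.1]
  · have h₁ := hR.2 v.fst
    have h₂ := hQ.2 v.snd
    rw [ContinuousLinearMap.reApplyInnerSelf_apply] at *
    rw [blockDiag_apply, WithLp.prod_inner_apply, map_add]
    exact add_nonneg h₁ h₂

theorem blockDiag_rpow {R : E →L[ℂ] E} {Q : F →L[ℂ] F} (hR : 0 ≤ R) (hQ : 0 ≤ Q) {p : ℝ}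
    (hp : 0 ≤ p) : blockDiag R Q ^ p = blockDiag (R ^ p) (Q ^ p) := by
  have h₁ := rpow_intertwine (J := inlL E F) (blockDiag_nonneg hR hQ) hR
    (by ext x : 1; simp [blockDiag_apply, inlL_apply]) hp
  have h₂ := rpow_intertwine (J := inrL E F) (blockDiag_nonneg hR hQ) hQ
    (by ext x : 1; simp [blockDiag_apply, inrL_apply]) hp
  ext v : 1
  conv_lhs => rw [← inlL_add_inrL v, map_add]
  exact congrArg₂ (· + ·) (DFunLike.congr_fun h₁ v.fst) (DFunLike.congr_fun h₂ v.snd)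

end Block

/-! ### Summability -/

section Summability

variable {E F : Type*}
  [NormedAddCommGroup E] [InnerProductSpace ℂ E] [CompleteSpace E]
  [NormedAddCommGroup F] [InnerProductSpace ℂ F] [CompleteSpace F]

theorem isSummable_iff {D : E →ₗ.[ℂ] E} {R : E →L[ℂ] E} (hR : IsInvOneAddSq D R) {s : ℝ} :
    IsSummable s D ↔ IsTraceClass (R ^ (s / 2)) := by
  constructor
  · rintro ⟨R', hR', h⟩
    rwa [hR'.unique hR] at h
  · exact fun h => ⟨R, hR, h⟩

/-- If the resolvents of `D₁` and `D₂` commute and `‖D₁ x‖ ≤ c ‖D₂ x‖` on `dom D₂`, then `D₂`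
inherits the summability of `D₁`. -/
theorem IsSummable.of_commute {D₁ D₂ : E →ₗ.[ℂ] E} {R₁ R₂ : E →L[ℂ] E} (hD₁ : IsSelfAdjoint D₁)
    (hD₂ : IsSelfAdjoint D₂) (h₁ : IsInvOneAddSq D₁ R₁) (h₂ : IsInvOneAddSq D₂ R₂)
    (hcomm : Commute R₂ R₁) {c : ℝ}
    (hc : ∀ x z, (x, z) ∈ D₂.graph → ∃ w, (x, w) ∈ D₁.graph ∧ ‖w‖ ≤ c * ‖z‖) {s : ℝ} (hs : 0 ≤ s)
    (h : IsSummable s D₁) : IsSummable s D₂ := by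
  rw [isSummable_iff h₁] at h
  rw [isSummable_iff h₂]
  exact h.of_le_smul CFC.rpow_nonneg CFC.rpow_nonneg
    (rpow_le_smul_rpow_of_commute (h₂.nonneg hD₂) (h₁.nonneg hD₁) hcomm (by positivity)
      (h₁.le_smul hD₁ hD₂ h₂ hc) (by positivity))

/-- Multiplying `D` with an invertible self-adjoint operator commuting with it does not affect its
summability. -/
theorem isSummable_boundedMul_iff {D : E →ₗ.[ℂ] E} {B B' : E →L[ℂ] E} (hD : IsSelfAdjoint D)
    (hB : IsSelfAdjoint B) (hBD : ∀ x y, (x, y) ∈ D.graph → (B x, B y) ∈ D.graph)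
    (hBD' : ∀ x y, (x, y) ∈ D.graph → (B' x, B' y) ∈ D.graph) (hinv : B' * B = 1) {s : ℝ}
    (hs : 0 ≤ s) : IsSummable s (boundedMul B D) ↔ IsSummable s D := by
  have hBD₂ := isSelfAdjoint_boundedMul hD hB hBD hBD' hinv
  obtain ⟨R, hR⟩ := hD.exists_isInvOneAddSq
  obtain ⟨S, hS⟩ := hBD₂.exists_isInvOneAddSq
  have hRB : ∀ y, R (B y) = B (R y) := fun y => DFunLike.congr_fun (hR.intertwine hR hBD) y
  have hcomm : Commute S R := hS.intertwine hS fun x y hxy => by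
    obtain ⟨z, hz, rfl⟩ := mem_graph_boundedMul.1 hxy
    exact mem_graph_boundedMul.2 ⟨R z, hR.map_graph hz, hRB z⟩
  constructor
  · refine IsSummable.of_commute hBD₂ hD hS hR hcomm.symm (c := ‖B‖) (fun x z hz => ?_) hs
    exact ⟨B z, mem_graph_boundedMul.2 ⟨z, hz, rfl⟩, B.le_opNorm z⟩
  · refine IsSummable.of_commute hD hBD₂ hR hS hcomm (c := ‖B'‖) (fun x z hz => ?_) hs
    obtain ⟨w, hw, rfl⟩ := mem_graph_boundedMul.1 hz
    refine ⟨w, hw, ?_⟩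
    have : w = B' (B w) := (DFunLike.congr_fun hinv w).symm
    conv_lhs => rw [this]
    exact B'.le_opNorm _

/-- A positive operator on `F ⊕ E` with the quadratic form of `J† T J ⊕ T` is of trace class exactly
if `T` is. -/
theorem isTraceClass_iff_of_inner_eq {T : E →L[ℂ] E}
    {U : WithLp 2 (F × E) →L[ℂ] WithLp 2 (F × E)} (hT : 0 ≤ T) (hU : 0 ≤ U) (J : F →L[ℂ] E)
    (h : ∀ v, (⟪v, U v⟫_ℂ).re = (⟪J v.fst, T (J v.fst)⟫_ℂ).re + (⟪v.snd, T v.snd⟫_ℂ).re) :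
    IsTraceClass U ↔ IsTraceClass T := by
  constructor
  · intro hU'
    refine isTraceClass_of_summable hT fun ι b => ?_
    have h₁ := summable_inner_of_isTraceClass hU hU' (inrL F E) b
    simp only [h] at h₁
    simpa [inrL_apply] using h₁
  · intro hT'
    refine isTraceClass_of_summable hU fun ι b => ?_
    simp only [h]
    exact (summable_inner_of_isTraceClass hT hT' (J ∘L WithLp.fstL 2 ℂ F E) b).add
      (summable_inner_of_isTraceClass hT hT' (WithLp.sndL 2 ℂ F E) b)

/-- Adding to `D` an operator `S` that is a part of `D`, in the sense that an isometry `J` maps the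
graph of `S` into the graph of `D`, does not affect its summability. -/
theorem isSummable_blockDiagPMap_iff {S : F →ₗ.[ℂ] F} {D : E →ₗ.[ℂ] E} (hS : IsSelfAdjoint S)
    (hD : IsSelfAdjoint D) {J : F →L[ℂ] E} (hJ : ∀ x y, ⟪J x, J y⟫_ℂ = ⟪x, y⟫_ℂ)
    (hJS : ∀ x y, (x, y) ∈ S.graph → (J x, J y) ∈ D.graph) {s : ℝ} (hs : 0 ≤ s) :
    IsSummable s (blockDiagPMap S D) ↔ IsSummable s D := by
  obtain ⟨R, hR⟩ := hD.exists_isInvOneAddSq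
  obtain ⟨Q, hQ⟩ := hS.exists_isInvOneAddSq
  have hR0 := hR.nonneg hD
  have hQ0 := hQ.nonneg hS
  have hs2 : 0 ≤ s / 2 := by positivity
  have hι : R ∘L J = J ∘L Q := hQ.intertwine hR hJS
  have hιp : ∀ x : F, (R ^ (s / 2)) (J x) = J ((Q ^ (s / 2)) x) := fun x =>
    DFunLike.congr_fun (rpow_intertwine hR0 hQ0 hι hs2) x
  rw [isSummable_iff hR, isSummable_iff (isInvOneAddSq_blockDiag hQ hR)]
  refine isTraceClass_iff_of_inner_eq CFC.rpow_nonneg CFC.rpow_nonneg J fun v => ?_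
  rw [blockDiag_rpow hQ0 hR0 hs2, blockDiag_apply, WithLp.prod_inner_apply, Complex.add_re,
    hιp, hJ]
  rfl

end Summability

/-! ### The Dirac operator on `PH ⊕ H` -/

section ExtDirac

variable {H : Type*} [NormedAddCommGroup H] [InnerProductSpace ℂ H]

section Mixing

variable (M : Submodule ℂ H) [CompleteSpace M] (α β : ℂ)

/-- The bounded operator `(x, w) ↦ (β P w, β x + α⁻¹ w)` on `K = PH ⊕ H`. In the decomposition
`K = PH ⊕ PH ⊕ (I - P)H` it is the matrix of `D_{α,β}` without the Dirac operators. -/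
def mixing : ExtSpace M →L[ℂ] ExtSpace M :=
  inlL M H ∘L (β • M.orthogonalProjectionOnto) ∘L WithLp.sndL 2 ℂ M H +
    inrL M H ∘L (β • M.subtypeL ∘L WithLp.fstL 2 ℂ M H + α⁻¹ • WithLp.sndL 2 ℂ M H)

/-- The inverse of `mixing M α β`. -/
def mixingInv : ExtSpace M →L[ℂ] ExtSpace M :=
  inlL M H ∘L (β⁻¹ • (M.orthogonalProjectionOnto ∘L WithLp.sndL 2 ℂ M H -
      (α⁻¹ * β⁻¹) • WithLp.fstL 2 ℂ M H)) +
    inrL M H ∘L (β⁻¹ • M.subtypeL ∘L WithLp.fstL 2 ℂ M H +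
      α • (1 - M.starProjection) ∘L WithLp.sndL 2 ℂ M H)

theorem mixing_apply (v : ExtSpace M) :
    mixing M α β v = WithLp.toLp 2 (β • M.orthogonalProjectionOnto v.snd,
      β • (v.fst : H) + α⁻¹ • v.snd) :=
  inlL_add_inrL (WithLp.toLp 2 (β • M.orthogonalProjectionOnto v.snd,
      β • (v.fst : H) + α⁻¹ • v.snd))

theorem mixingInv_apply (v : ExtSpace M) :
    mixingInv M α β v = WithLp.toLp 2
      (β⁻¹ • (M.orthogonalProjectionOnto v.snd - (α⁻¹ * β⁻¹) • v.fst),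
        β⁻¹ • (v.fst : H) + α • (v.snd - M.starProjection v.snd)) :=
  inlL_add_inrL (WithLp.toLp 2
      (β⁻¹ • (M.orthogonalProjectionOnto v.snd - (α⁻¹ * β⁻¹) • v.fst),
        β⁻¹ • (v.fst : H) + α • (v.snd - M.starProjection v.snd)))

variable {α β} in
theorem mixingInv_mul_mixing (hα : α ≠ 0) (hβ : β ≠ 0) : mixingInv M α β * mixing M α β = 1 := by
  ext v : 1
  change mixingInv M α β (mixing M α β v) = v
  rw [mixing_apply, mixingInv_apply]
  refine prod_ext ?_ ?_
  · change β⁻¹ • (M.orthogonalProjectionOnto (β • (v.fst : H) + α⁻¹ • v.snd) -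
      (α⁻¹ * β⁻¹) • β • M.orthogonalProjectionOnto v.snd) = v.fst
    rw [map_add, map_smul, map_smul, M.orthogonalProjectionOnto_mem_subspace_eq_self, smul_smul,
      mul_assoc, inv_mul_cancel₀ hβ, mul_one, add_sub_cancel_right, inv_smul_smul₀ hβ]
  · change β⁻¹ • ((β • M.orthogonalProjectionOnto v.snd : M) : H) +
      α • ((β • (v.fst : H) + α⁻¹ • v.snd) - M.starProjection (β • (v.fst : H) + α⁻¹ • v.snd)) =
        v.snd
    rw [map_add, map_smul, map_smul, M.starProjection_mem_subspace_eq_self, add_sub_add_left_eq_sub,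
      ← smul_sub, smul_inv_smul₀ hα, Submodule.coe_smul, inv_smul_smul₀ hβ]
    exact add_sub_cancel _ _

variable [CompleteSpace H]

theorem isSelfAdjoint_mixing (α β : ℝ) : IsSelfAdjoint (mixing M (α : ℂ) (β : ℂ)) := by
  rw [ContinuousLinearMap.isSelfAdjoint_iff_isSymmetric]
  intro v w
  change ⟪mixing M α β v, w⟫_ℂ = ⟪v, mixing M α β w⟫_ℂ
  rw [mixing_apply, mixing_apply, WithLp.prod_inner_apply, WithLp.prod_inner_apply]
  change ⟪(β : ℂ) • M.orthogonalProjectionOnto v.snd, w.fst⟫_ℂ +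
      ⟪(β : ℂ) • (v.fst : H) + (α : ℂ)⁻¹ • v.snd, w.snd⟫_ℂ =
    ⟪v.fst, (β : ℂ) • M.orthogonalProjectionOnto w.snd⟫_ℂ +
      ⟪v.snd, (β : ℂ) • (w.fst : H) + (α : ℂ)⁻¹ • w.snd⟫_ℂ
  simp only [inner_add_left, inner_add_right, inner_smul_left, inner_smul_right, map_inv₀,
    Complex.conj_ofReal, M.inner_orthogonalProjectionOnto_eq_of_mem_left,
    M.inner_orthogonalProjectionOnto_eq_of_mem_right]
  ring

end Mixing

variable {M : Submodule ℂ H} [CompleteSpace M] {D : H →ₗ.[ℂ] H}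

theorem ProjCommutes.mixing_graph (hM : ProjCommutes D M) (α β : ℂ) (v w : ExtSpace M)
    (h : (v, w) ∈ (blockDiagPMap (restrict D M) D).graph) :
    (mixing M α β v, mixing M α β w) ∈ (blockDiagPMap (restrict D M) D).graph := by
  obtain ⟨h₁, h₂⟩ := mem_graph_blockDiagPMap.1 h
  rw [mixing_apply, mixing_apply]
  exact mem_graph_blockDiagPMap.2 ⟨(restrict D M).graph.smul_mem β (hM.onto_graph h₂),
    D.graph.add_mem (D.graph.smul_mem β (hM.mem_graph_restrict.1 h₁)) (D.graph.smul_mem α⁻¹ h₂)⟩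

theorem ProjCommutes.mixingInv_graph (hM : ProjCommutes D M) (α β : ℂ) (v w : ExtSpace M)
    (h : (v, w) ∈ (blockDiagPMap (restrict D M) D).graph) :
    (mixingInv M α β v, mixingInv M α β w) ∈ (blockDiagPMap (restrict D M) D).graph := by
  obtain ⟨h₁, h₂⟩ := mem_graph_blockDiagPMap.1 h
  rw [mixingInv_apply, mixingInv_apply]
  exact mem_graph_blockDiagPMap.2 ⟨(restrict D M).graph.smul_mem _
      ((restrict D M).graph.sub_mem (hM.onto_graph h₂) ((restrict D M).graph.smul_mem _ h₁)),
    D.graph.add_mem (D.graph.smul_mem _ (hM.mem_graph_restrict.1 h₁))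
      (D.graph.smul_mem _ (D.graph.sub_mem h₂ (hM.map_graph h₂)))⟩

variable [CompleteSpace H]

omit [CompleteSpace M] [CompleteSpace H] in
theorem in₁_add_in₂_add_in₃ (a b : M) (c : Mᗮ) :
    in₁ M a + in₂ M b + in₃ M c = WithLp.toLp 2 (a, (b : H) + c) := by
  refine prod_ext ?_ ?_
  · change a + 0 + 0 = a
    rw [add_zero, add_zero]
  · change 0 + (b : H) + c = b + c
    rw [zero_add]

/-- `D_{α,β}` is a bounded multiple of `D_p ⊕ D`. -/
theorem ProjCommutes.extDirac_eq (hM : ProjCommutes D M) (α β : ℝ) :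
    extDirac M D α β = boundedMul (mixing M α β) (blockDiagPMap (restrict D M) D) := by
  refine LinearPMap.eq_of_eq_graph (Submodule.ext fun ⟨v, w⟩ => ?_)
  rw [extDirac]
  simp only [mem_graph_add, mem_graph_boundedMul, mem_graph_smul, mem_graph_mulBounded,
    mem_graph_blockDiagPMap]
  constructor
  · rintro ⟨_, _, ⟨_, _, ⟨_, ⟨y, hy, rfl⟩, rfl⟩,
      ⟨_, ⟨_, _, ⟨p, hp, rfl⟩, ⟨y', hy', rfl⟩, rfl⟩, rfl⟩, rfl⟩, ⟨_, ⟨r, hr, rfl⟩, rfl⟩, rfl⟩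
    obtain rfl : y = y' := LinearPMap.mem_graph_snd_inj _ hy hy' rfl
    have hq : (v.snd, (y : H) + r) ∈ D.graph := by
      have := D.graph.add_mem (hM.mem_graph_restrict.1 hy) (hM.orthogonal.mem_graph_restrict.1 hr)
      have e : ((pr₂ M v : M) : H) + (pr₃ M v : Mᗮ) = v.snd :=
        M.starProjection_add_starProjection_orthogonal v.snd
      rwa [Prod.mk_add_mk, e] at this
    refine ⟨WithLp.toLp 2 (p, (y : H) + r), ⟨hp, hq⟩, ?_⟩
    rw [mixing_apply, in₁_add_in₂_add_in₃]
    refine prod_ext ?_ ?_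
    · change (β : ℂ) • y = (β : ℂ) • M.orthogonalProjectionOnto ((y : H) + r)
      rw [map_add, M.orthogonalProjectionOnto_mem_subspace_eq_self,
        Submodule.orthogonalProjectionOnto_eq_zero_iff.2 r.2, add_zero]
    · change ((β : ℂ) • (p : H) + (α : ℂ)⁻¹ • (y : H)) + (α : ℂ)⁻¹ • (r : H) =
        (β : ℂ) • (p : H) + (α : ℂ)⁻¹ • ((y : H) + r)
      rw [smul_add, add_assoc]
  · rintro ⟨u, ⟨h₁, h₂⟩, rfl⟩
    refine ⟨_, _, ⟨_, _, ⟨_, ⟨_, hM.onto_graph h₂, rfl⟩, rfl⟩,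
      ⟨_, ⟨_, _, ⟨_, h₁, rfl⟩, ⟨_, hM.onto_graph h₂, rfl⟩, rfl⟩, rfl⟩,
      rfl⟩, ⟨_, ⟨_, hM.orthogonal.onto_graph h₂, rfl⟩, rfl⟩, ?_⟩
    rw [mixing_apply, in₁_add_in₂_add_in₃]
    refine prod_ext ?_ ?_
    · rfl
    · change (β : ℂ) • (u.fst : H) + (α : ℂ)⁻¹ • u.snd =
        ((β : ℂ) • (u.fst : H) + (α : ℂ)⁻¹ • M.starProjection u.snd) +
          (α : ℂ)⁻¹ • Mᗮ.starProjection u.snd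
      rw [add_assoc, ← smul_add, M.starProjection_add_starProjection_orthogonal]

theorem ProjCommutes.isSelfAdjoint_extDirac (hM : ProjCommutes D M) (hD : IsSelfAdjoint D)
    {α β : ℝ} (hα : α ≠ 0) (hβ : β ≠ 0) : IsSelfAdjoint (extDirac M D α β) := by
  rw [hM.extDirac_eq]
  exact isSelfAdjoint_boundedMul (isSelfAdjoint_blockDiagPMap (hM.isSelfAdjoint_restrict hD) hD)
    (isSelfAdjoint_mixing M α β) (hM.mixing_graph α β) (hM.mixingInv_graph α β)
    (mixingInv_mul_mixing M (Complex.ofReal_ne_zero.2 hα) (Complex.ofReal_ne_zero.2 hβ))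

omit [CompleteSpace H] in
/-- The resolvent of `D_p` is a compression of the resolvent of `D`. -/
theorem ProjCommutes.isCompactOperator_restrict (hM : ProjCommutes D M) {R : H →L[ℂ] H}
    {Q : M →L[ℂ] M} (hR : IsInvOneAddSq D R) (hRc : IsCompactOperator R)
    (hQ : IsInvOneAddSq (restrict D M) Q) : IsCompactOperator Q := by
  have hι : R ∘L M.subtypeL = M.subtypeL ∘L Q :=
    hQ.intertwine hR fun x y hxy => hM.mem_graph_restrict.1 hxy
  have : Q = M.orthogonalProjectionOnto ∘L (R ∘L M.subtypeL) := by
    rw [hι]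
    ext x : 1
    exact (M.orthogonalProjectionOnto_mem_subspace_eq_self (Q x)).symm
  rw [this]
  exact (hRc.comp_clm M.subtypeL).clm_comp M.orthogonalProjectionOnto

/-- `D_{α,β}` has a compact resolvent if `D` has. -/
theorem ProjCommutes.exists_isCompactOperator_extDirac (hM : ProjCommutes D M)
    (hD : IsSelfAdjoint D) (hc : ∃ R : H →L[ℂ] H, IsInvOneAddSq D R ∧ IsCompactOperator R)
    {α β : ℝ} (hα : α ≠ 0) (hβ : β ≠ 0) :
    ∃ S : ExtSpace M →L[ℂ] ExtSpace M,
      IsInvOneAddSq (extDirac M D α β) S ∧ IsCompactOperator S := by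
  obtain ⟨R, hR, hRc⟩ := hc
  obtain ⟨Q, hQ⟩ := (hM.isSelfAdjoint_restrict hD).exists_isInvOneAddSq
  obtain ⟨S, hS⟩ := (hM.isSelfAdjoint_extDirac hD hα hβ).exists_isInvOneAddSq
  refine ⟨S, hS, ?_⟩
  rw [hM.extDirac_eq] at hS
  rw [IsInvOneAddSq.boundedMul_eq (hM.mixingInv_graph α β)
    (mixingInv_mul_mixing M (Complex.ofReal_ne_zero.2 hα) (Complex.ofReal_ne_zero.2 hβ))
    (isInvOneAddSq_blockDiag hQ hR) hS]
  exact (isCompactOperator_blockDiag (hM.isCompactOperator_restrict hR hRc hQ) hRc).comp_clm _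

theorem ProjCommutes.isSummable_extDirac_iff (hM : ProjCommutes D M) (hD : IsSelfAdjoint D)
    {α β : ℝ} (hα : α ≠ 0) (hβ : β ≠ 0) {s : ℝ} (hs : 0 ≤ s) :
    IsSummable s (extDirac M D α β) ↔ IsSummable s D := by
  rw [hM.extDirac_eq]
  have hinv := mixingInv_mul_mixing M (Complex.ofReal_ne_zero.2 hα) (Complex.ofReal_ne_zero.2 hβ)
  refine (isSummable_boundedMul_iff
    (isSelfAdjoint_blockDiagPMap (hM.isSelfAdjoint_restrict hD) hD)
    (isSelfAdjoint_mixing M α β) (hM.mixing_graph α β) (hM.mixingInv_graph α β) hinv hs).trans ?_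
  exact isSummable_blockDiagPMap_iff (hM.isSelfAdjoint_restrict hD) hD (J := M.subtypeL)
    (fun _ _ => rfl) (fun x y hxy => hM.mem_graph_restrict.1 hxy) hs

end ExtDirac

/-! ### The spectral triple on the Toeplitz extension -/

section Triple

variable {H : Type*} [NormedAddCommGroup H] [InnerProductSpace ℂ H] [CompleteSpace H]
  {M : Submodule ℂ H} [CompleteSpace M] {D : H →ₗ.[ℂ] H} {𝓐 : StarSubalgebra ℂ (H →L[ℂ] H)}
  [IsClosed (𝓐 : Set (H →L[ℂ] H))] {A : Set 𝓐}

section Commutator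

variable (hQ : IsToeplitzQuadruple 𝓐 A D M)
include hQ

/-- The first component of the commutator `[D_{α,β}, π(t)]`, up to the factor `β`. -/
theorem IsToeplitzQuadruple.exists_bound_fst {a : 𝓐} (ha : a ∈ A) {k : M →L[ℂ] M}
    (hk : k ∈ smoothCompacts D M) :
    ∃ C : ℝ, 0 ≤ C ∧ ∀ w q q', (w, q) ∈ D.graph → ((a : H →L[ℂ] H) w, q') ∈ D.graph →
      ‖M.orthogonalProjectionOnto q' -
        (compress M (a : H →L[ℂ] H) + k) (M.orthogonalProjectionOnto q)‖ ≤ C * ‖w‖ := by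
  obtain ⟨C₁, hC₁, h₁⟩ := hQ.exists_bound_commutator_p ha
  obtain ⟨-, C₂, hC₂, h₂⟩ := isDenselyDefinedBounded_iff.1 hk.2.2
  refine ⟨C₁ + C₂, by positivity, fun w q q' hq hq' => ?_⟩
  have e : M.orthogonalProjectionOnto q' -
      (compress M (a : H →L[ℂ] H) + k) (M.orthogonalProjectionOnto q) =
      M.orthogonalProjectionOnto
        (M.starProjection q' - (a : H →L[ℂ] H) (M.starProjection q)) -
        k (M.orthogonalProjectionOnto q) := by
    rw [map_sub, add_apply, ← sub_sub]
    congr 2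
    exact (M.orthogonalProjectionOnto_mem_subspace_eq_self _).symm
  rw [e, add_mul]
  refine (norm_sub_le _ _).trans (add_le_add ?_ ?_)
  · exact (M.norm_orthogonalProjectionOnto_apply_le _).trans (h₁ w q q' hq hq')
  · refine (h₂ _ _ (mem_graph_boundedMul.2 ⟨_, hQ.projCommutes.onto_graph hq, rfl⟩)).trans ?_
    gcongr
    exact M.norm_orthogonalProjectionOnto_apply_le w

variable (hdom : ∀ a ∈ A, ∀ x ∈ (restrict D M).domain,
      compress M (a : H →L[ℂ] H) x ∈ (restrict D M).domain)
include hdom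

/-- The operator `D_p t - a D_p` from `PH` to `H`, which occurs in the second component of the
commutator `[D_{α,β}, π(t)]`, is bounded. -/
theorem IsToeplitzQuadruple.exists_bound_snd {a : 𝓐} (ha : a ∈ A) {k : M →L[ℂ] M}
    (hk : k ∈ smoothCompacts D M) :
    ∃ C : ℝ, 0 ≤ C ∧ ∀ x p, (x, p) ∈ (restrict D M).graph →
      ∃ p', ((compress M (a : H →L[ℂ] H) + k) x, p') ∈ (restrict D M).graph ∧
        ‖(p' : H) - (a : H →L[ℂ] H) p‖ ≤ C * ‖x‖ := by
  obtain ⟨C₁, hC₁, h₁⟩ := hQ.exists_bound_commutator_compress hdom ha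
  obtain ⟨C₂, hC₂, h₂⟩ := ((mem_smoothCompacts_iff hQ.isSelfAdjoint_restrict).1 hk).2.1
  obtain ⟨-, C₃, hC₃, h₃⟩ := isDenselyDefinedBounded_iff.1
    (hQ.isDenselyDefinedBounded_corner_mul_restrict ha)
  refine ⟨C₁ + C₂ + C₃, by positivity, fun x p hp => ?_⟩
  obtain ⟨z, hz, hzC⟩ := h₁ x p hp
  obtain ⟨y, hy, hyC⟩ := h₂ x
  refine ⟨z + y, (restrict D M).graph.add_mem hz hy, ?_⟩
  have h₄ := h₃ x _ (mem_graph_boundedMul.2 ⟨p, hp, rfl⟩)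
  have e : ((z + y : M) : H) - (a : H →L[ℂ] H) p =
      ((z - compress M (a : H →L[ℂ] H) p : M) : H) + y -
        Mᗮ.starProjection ((a : H →L[ℂ] H) p) := by
    rw [M.starProjection_orthogonal_val]
    change (z : H) + y - (a : H →L[ℂ] H) p = z - M.starProjection ((a : H →L[ℂ] H) p) + y -
      ((a : H →L[ℂ] H) p - M.starProjection ((a : H →L[ℂ] H) p))
    abel
  rw [e, add_mul, add_mul]
  exact (norm_sub_le _ _).trans (add_le_add ((norm_add_le _ _).trans (add_le_add hzC hyC)) h₄)

/-- The commutators of `D_{α,β}` with the operators `(T(a) + k) ⊕ a` are bounded. -/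
theorem IsToeplitzQuadruple.commutator_extDirac {a : 𝓐} (ha : a ∈ A) {k : M →L[ℂ] M}
    (hk : k ∈ smoothCompacts D M) (α β : ℝ) :
    IsDenselyDefinedBounded (opCommutator (extDirac M D α β)
      (blockDiag (compress M (a : H →L[ℂ] H) + k) (a : H →L[ℂ] H))) := by
  obtain ⟨C₁, hC₁, h₁⟩ := hQ.exists_bound_fst ha hk
  obtain ⟨C₂, hC₂, h₂⟩ := hQ.exists_bound_snd hdom ha hk
  obtain ⟨hdense, C₃, hC₃, h₃⟩ := isDenselyDefinedBounded_iff.1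
    (hQ.isSpectralTriple.commutator_bounded a ha)
  rw [hQ.projCommutes.extDirac_eq, isDenselyDefinedBounded_iff]
  refine ⟨?_, ?_⟩
  · refine (dense_prod hQ.isSelfAdjoint_restrict.dense_domain hdense).mono ?_
    rintro v ⟨hv₁, hv₂⟩
    obtain ⟨p, hp⟩ := mem_domain_iff_exists_graph.1 hv₁
    obtain ⟨_, hv₂⟩ := mem_domain_iff_exists_graph.1 hv₂
    obtain ⟨q', q, hq', hq, -⟩ := mem_graph_opCommutator.1 hv₂
    obtain ⟨p', hp', -⟩ := h₂ _ _ hp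
    refine mem_domain_iff_exists_graph.2 ⟨_, mem_graph_opCommutator.2 ⟨_, _,
      mem_graph_boundedMul.2 ⟨WithLp.toLp 2 (p', q'), mem_graph_blockDiagPMap.2 ?_, rfl⟩,
      mem_graph_boundedMul.2 ⟨WithLp.toLp 2 (p, q), mem_graph_blockDiagPMap.2 ⟨hp, hq⟩, rfl⟩, rfl⟩⟩
    rw [blockDiag_apply]
    exact ⟨hp', hq'⟩
  · refine ⟨|β| * C₁ + (|β| * C₂ + |α⁻¹| * C₃), by positivity, fun v y hy => ?_⟩
    obtain ⟨_, _, hu, hv, rfl⟩ := mem_graph_opCommutator.1 hy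
    obtain ⟨w', hw', rfl⟩ := mem_graph_boundedMul.1 hu
    obtain ⟨w, hw, rfl⟩ := mem_graph_boundedMul.1 hv
    rw [blockDiag_apply, mem_graph_blockDiagPMap] at hw'
    rw [mem_graph_blockDiagPMap] at hw
    have hfst := h₁ _ _ _ hw.2 hw'.2
    obtain ⟨p', hp', hsnd⟩ := h₂ _ _ hw.1
    obtain rfl : p' = w'.fst := LinearPMap.mem_graph_snd_inj _ hp' hw'.1 rfl
    have hsnd' := h₃ v.snd _ (mem_graph_opCommutator.2 ⟨_, _, hw'.2, hw.2, rfl⟩)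
    have hv₁ := norm_fst_le v
    have hv₂ := norm_snd_le v
    set y := mixing M (α : ℂ) (β : ℂ) w' -
      blockDiag (compress M (a : H →L[ℂ] H) + k) (a : H →L[ℂ] H) (mixing M α β w) with hy_def
    have e₁ : y.fst = (β : ℂ) • (M.orthogonalProjectionOnto w'.snd -
        (compress M (a : H →L[ℂ] H) + k) (M.orthogonalProjectionOnto w.snd)) := by
      have : y.fst = (β : ℂ) • M.orthogonalProjectionOnto w'.snd -
          (compress M (a : H →L[ℂ] H) + k) ((β : ℂ) • M.orthogonalProjectionOnto w.snd) := by
        rw [hy_def, mixing_apply, mixing_apply, blockDiag_apply]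
        rfl
      rw [this, map_smul, smul_sub]
    have e₂ : y.snd = (β : ℂ) • ((w'.fst : H) - (a : H →L[ℂ] H) w.fst) +
        (α : ℂ)⁻¹ • (w'.snd - (a : H →L[ℂ] H) w.snd) := by
      have : y.snd = ((β : ℂ) • (w'.fst : H) + (α : ℂ)⁻¹ • w'.snd) -
          (a : H →L[ℂ] H) ((β : ℂ) • (w.fst : H) + (α : ℂ)⁻¹ • w.snd) := by
        rw [hy_def, mixing_apply, mixing_apply, blockDiag_apply]
        rfl
      rw [this, map_add, map_smul, map_smul, smul_sub, smul_sub]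
      abel
    have hβ : ‖(β : ℂ)‖ = |β| := Complex.norm_real β
    have hα : ‖(α : ℂ)⁻¹‖ = |α⁻¹| := by rw [← Complex.ofReal_inv]; exact Complex.norm_real _
    refine (norm_le_add_norm y).trans ?_
    rw [add_mul]
    refine add_le_add ?_ ?_
    · rw [e₁, norm_smul, hβ, mul_assoc]
      gcongr
      exact hfst.trans (by gcongr)
    · rw [e₂, add_mul, mul_assoc, mul_assoc]
      refine (norm_add_le _ _).trans (add_le_add ?_ ?_)
      · rw [norm_smul, hβ]
        gcongr
        exact hsnd.trans (by gcongr)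
      · rw [norm_smul, hα]
        gcongr
        exact hsnd'.trans (by gcongr)

end Commutator

/-- The representation `t ↦ t ⊕ ρ(t)` of the Toeplitz extension on `PH ⊕ H`. -/
def extRep (ρ : toeplitzExtension 𝓐 M →⋆ₐ[ℂ] 𝓐) :
    toeplitzExtension 𝓐 M →⋆ₐ[ℂ] (ExtSpace M →L[ℂ] ExtSpace M) :=
  blockDiagHom (E := M) (F := H) (toeplitzExtension 𝓐 M).subtype (𝓐.subtype.comp ρ)

omit [IsClosed (𝓐 : Set (H →L[ℂ] H))] in
theorem extRep_eq (ρ : toeplitzExtension 𝓐 M →⋆ₐ[ℂ] 𝓐) (t : toeplitzExtension 𝓐 M) :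
    extRep ρ t = blockDiag (t : M →L[ℂ] M) (ρ t : H →L[ℂ] H) := rfl

omit [IsClosed (𝓐 : Set (H →L[ℂ] H))] in
theorem extRep_apply (ρ : toeplitzExtension 𝓐 M →⋆ₐ[ℂ] 𝓐) (t : toeplitzExtension 𝓐 M) (x : M)
    (y : H) : extRep ρ t (WithLp.toLp 2 (x, y)) =
      WithLp.toLp 2 ((t : M →L[ℂ] M) x, (ρ t : H →L[ℂ] H) y) := by
  rw [extRep_eq]
  exact blockDiag_apply _ _ _

omit [IsClosed (𝓐 : Set (H →L[ℂ] H))] in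
theorem extRep_injective (ρ : toeplitzExtension 𝓐 M →⋆ₐ[ℂ] 𝓐) :
    Function.Injective (extRep ρ) := by
  intro t t' h
  refine Subtype.ext (ContinuousLinearMap.ext fun x => ?_)
  have h₁ := congrArg WithLp.fst
    (DFunLike.congr_fun h (WithLp.toLp 2 (x, (0 : H)) : ExtSpace M))
  rw [extRep_apply, extRep_apply] at h₁
  exact h₁

omit [IsClosed (𝓐 : Set (H →L[ℂ] H))] in
theorem phi_eq_calkinMk_iff {b : 𝓐} {t : M →L[ℂ] M} :
    phi 𝓐 M b = calkinMk M t ↔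
      IsCompactOperator (t - compress M (b : H →L[ℂ] H) : M →L[ℂ] M) := by
  rw [eq_comm]
  exact Ideal.Quotient.eq

theorem IsToeplitzQuadruple.isSpectralTriple_extDirac (hQ : IsToeplitzQuadruple 𝓐 A D M)
    (hdom : ∀ a ∈ A, ∀ x ∈ (restrict D M).domain,
      compress M (a : H →L[ℂ] H) x ∈ (restrict D M).domain)
    {ρ : toeplitzExtension 𝓐 M →⋆ₐ[ℂ] 𝓐} (hρ : ∀ t : toeplitzExtension 𝓐 M,
      phi 𝓐 M (ρ t) = calkinMk M (t : M →L[ℂ] M)) {α β : ℝ} (hα : α ≠ 0) (hβ : β ≠ 0) :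
    IsSpectralTriple (extRep ρ) (smoothToeplitz 𝓐 A D M) (extDirac M D α β) where
  faithful := extRep_injective ρ
  isSelfAdjoint := hQ.projCommutes.isSelfAdjoint_extDirac hQ.isSelfAdjoint hα hβ
  isSubalgebra := hQ.isSubalgebra_smoothToeplitz hdom
  dense := hQ.dense_smoothToeplitz fun t => phi_eq_calkinMk_iff.1 (hρ t)
  commutator_bounded := by
    rintro t ⟨a, ha, k, hk, ht⟩
    -- `ρ(T(a) + k) = a`, since `φ` is injective
    have hρt : ρ t = a := by
      refine hQ.isToeplitzProjection.faithful ((hρ t).trans (phi_eq_calkinMk_iff.2 ?_).symm)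
      rw [ht, add_sub_cancel_left]
      exact hk.1
    rw [extRep_eq, hρt, ht]
    exact hQ.commutator_extDirac hdom ha hk α β
  compact := hQ.projCommutes.exists_isCompactOperator_extDirac hQ.isSelfAdjoint
    hQ.isSpectralTriple.compact hα hβ

end Triple

end

end ToeplitzTriple

open ToeplitzTriple in
theorem mainTheorem3 {H : Type*} [NormedAddCommGroup H] [InnerProductSpace ℂ H] [CompleteSpace H]
    (𝓐 : StarSubalgebra ℂ (H →L[ℂ] H)) [IsClosed (𝓐 : Set (H →L[ℂ] H))] (A : Set 𝓐)
    (D : H →ₗ.[ℂ] H) (M : Submodule ℂ H) [CompleteSpace M]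
    (hQ : IsToeplitzQuadruple 𝓐 A D M)
    (hdom : ∀ a ∈ A, ∀ x ∈ (restrict D M).domain,
      compress M (a : H →L[ℂ] H) x ∈ (restrict D M).domain) :
    (∃ (ρ : toeplitzExtension 𝓐 M →⋆ₐ[ℂ] 𝓐)
        (π : toeplitzExtension 𝓐 M →⋆ₐ[ℂ] (ExtSpace M →L[ℂ] ExtSpace M)),
      (∀ t : toeplitzExtension 𝓐 M, phi 𝓐 M (ρ t) = calkinMk M (t : M →L[ℂ] M)) ∧
      (∀ (t : toeplitzExtension 𝓐 M) (x : M) (y : H),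
        π t (WithLp.toLp 2 (x, y)) =
          WithLp.toLp 2 ((t : M →L[ℂ] M) x, (ρ t : H →L[ℂ] H) y)) ∧
      ∀ α β : ℝ, 0 < α → 0 < β → α * β ≤ 1 →
        IsSpectralTriple π (smoothToeplitz 𝓐 A D M) (extDirac M D α β)) ∧
    ∀ α β : ℝ, 0 < α → 0 < β → α * β ≤ 1 →
      ∀ s : ℝ, 0 < s → (IsSummable s (extDirac M D α β) ↔ IsSummable s D) := by
  obtain ⟨ρ, hρ⟩ := exists_symbol_hom hQ.isToeplitzProjection.commutes_mod_compact
    hQ.isToeplitzProjection.faithful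
  have hρ' := fun t : toeplitzExtension 𝓐 M => phi_eq_calkinMk_iff.2 (hρ t)
  refine ⟨⟨ρ, extRep ρ, hρ', extRep_apply ρ, fun α β hα hβ _ => ?_⟩,
    fun α β hα hβ _ s hs => ?_⟩
  · exact hQ.isSpectralTriple_extDirac hdom hρ' hα.ne' hβ.ne'
  · exact hQ.projCommutes.isSummable_extDirac_iff hQ.isSelfAdjoint hα.ne' hβ.ne' hs.le
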